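/- **Definitions.** Let $\mathbb N=\{1,2,\dots\}$, $[n]=\{1,\dots,n\}$, $\mathbf x=(x_1,x_2,\dots)$, $\mathbf t=(t_1,t_2,\dots)$, and let $S_n$ be regarded as a subgroup of the group $S_\infty$ of finitary permutations of $\mathbb N$. *Noncrossing permutations.* A set partition of $[n]$ is noncrossing if there are no distinct blocks $P,Q$ with $a,b\in P$, $c,d\in Q$ and $a<c<b<d$. Its noncrossing permutation in $S_n$ is the product over its blocks $B=\{a_p>a_{p-1}>\dots>a_1\}$ of the cycles $(a_p\,a_{p-1}\cdots a_1)$, sending $a_p\mapsto a_{p-1}\mapsto\dots\mapsto a_1\mapsto a_p$. Let $\mathrm{NC}_n\subset S_n$ be the set of these permutations. The Bruhat order is: $\sigma\le\tau$ iff some reduced word of $\sigma$ in the adjacent transpositions is a subword of some reduced word of $\tau$. *Forests.* An indexed forest is a sequence $F=(T_1,T_2,\dots)$ of binary plane trees (every node has two children, left and right, or is a leaf), all but finitely many of which are the one-node tree; $\emptyset$ is the forest all of whose trees are trivial. The leaves of $F$ are labelled $1,2,3,\dots$ from left to right. $\mathsf{Forest}_n$ is the set of forests all of whose nontrivial trees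 have all their leaves in $[n]$. A terminal node is an internal node both of whose children are leaves; $\mathrm{QDes}(F)$ is the set of labels of left children of terminal nodes, and for $i\in\mathrm{QDes}(F)$ the forest $F/i$ is obtained by deleting the terminal node whose left child is the leaf $i$ (replacing it by a leaf). *The map $\mathrm{ForToNC}$.* For $F\in\mathsf{Forest}_n$, treat every internal node $v$ of $F$ that is a right child as follows: delete $v$, cut off its left subtree as a separate tree, and let the right child of $v$ take the place of $v$. The sets of leaves in $[n]$ of the resulting trees are the blocks of a set partition of $[n]$, and $\mathrm{ForToNC}(F)$ is the product of the backwards cycles, as above, of these blocks. *Double forest polynomials.* For $f\in\mathbb Z[\mathbf t][\mathbf x]$ put $$\mathsf E_i f=\frac{f(x_1,\dots,x_{i-1},x_i,t_i,x_{i+1},\dots;\mathbf t)-f(x_1,\dots,x_{i-1},t_i,x_i,x_{i+1},\dots;\mathbf t)}{x_i-t_i},$$ and $\operatorname{ev}_\sigma f=f(t_{\sigma(1)},t_{\sigma(2)},\dots;\mathbf t)\in\mathbb Z[\mathbf t]$ for $\sigma\in S_\infty$. The double forest polynomials are the unique family $(\mathfrak P_F)$, indexed by all indexed forests $F$, of polynomials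 in $\mathbb Z[\mathbf t][\mathbf x]$, each homogeneous in the variables $\mathbf x$ and $\mathbf t$ together, such that $\mathfrak P_F(\mathbf t;\mathbf t)$ is $1$ if $F=\emptyset$ and $0$ otherwise, and such that for every $i$, $\mathsf E_i\mathfrak P_F=\mathfrak P_{F/i}(\mathbf x;t_1,\dots,t_{i-1},t_{i+1},\dots)$ if $i\in\mathrm{QDes}(F)$ and $\mathsf E_i\mathfrak P_F=0$ otherwise. **Theorem.** There is exactly one family $(\mathfrak P_F)$ as above, and for every $n\ge 0$: 1. $\mathrm{ForToNC}$ is a bijection from $\mathsf{Forest}_n$ to $\mathrm{NC}_n$. 2. For all $\sigma\in\mathrm{NC}_n$ and $F\in\mathsf{Forest}_n$, $\operatorname{ev}_\sigma(\mathfrak P_F)=0$ if and only if $\mathrm{ForToNC}(F)\not\le\sigma$ in the Bruhat order. 3. Hence evaluations of double forest polynomials characterize the Bruhat order restricted to $\mathrm{NC}_n$: for all $\sigma,\tau\in\mathrm{NC}_n$, $\tau\le\sigma$ if and only if $\operatorname{ev}_\sigma(\mathfrak P_{\mathrm{ForToNC}^{-1}(\tau)})\ne 0$. -/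

import Mathlib

/-
Everything is indexed from `0`: the label, variable or letter written `i + 1` with positive
integers is `i : ℕ` here, and `[n]` is `{0, …, n - 1}`.
-/

namespace DoubleForest

/-! ### Permutations, noncrossing partitions and the Bruhat order -/

/-- The adjacent transposition exchanging `i` and `i + 1`. -/
def simpleTransposition (i : ℕ) : Equiv.Perm ℕ := Equiv.swap i (i + 1)

/-- The product of adjacent transpositions spelled by a word. -/
def wordProd (w : List ℕ) : Equiv.Perm ℕ := (w.map simpleTransposition).prod

/-- `w` is a reduced word of `σ`: a shortest word in the adjacent transpositions whose
product is `σ`. -/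
def IsReducedWord (w : List ℕ) (σ : Equiv.Perm ℕ) : Prop :=
  wordProd w = σ ∧ ∀ v : List ℕ, wordProd v = σ → w.length ≤ v.length

/-- The strong Bruhat order: some reduced word of `σ` is a subword of some reduced word of `τ`.
(The finite symmetric group on `[n]` sits in the finitary permutations of `ℕ`; reduced words
of its elements only use the letters `i` with `i + 1 < n`.) -/
def BruhatLE (σ τ : Equiv.Perm ℕ) : Prop :=
  ∃ v w : List ℕ, IsReducedWord v σ ∧ IsReducedWord w τ ∧ v.Sublist w

/-- The backwards cycle `(a_p a_{p-1} ⋯ a_1)` of a finite set `{a_p > a_{p-1} > ⋯ > a_1}`,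
sending each element to the next smaller one and the minimum to the maximum. -/
def backwardCycle (B : Finset ℕ) : Equiv.Perm ℕ := (B.sort (· ≥ ·)).formPerm

/-- The product of the backwards cycles of a list of blocks. It is used for pairwise disjoint
blocks only, where the cycles commute and the order of the list does not matter. -/
def blocksPerm (L : List (Finset ℕ)) : Equiv.Perm ℕ := (L.map backwardCycle).prod

/-- A set partition of `[n]` is noncrossing if no two distinct blocks contain
`a < c < b < d` with `a, b` in the one and `c, d` in the other. -/
def IsNoncrossing {n : ℕ} (P : Finpartition (Finset.range n)) : Prop :=
  ∀ B ∈ P.parts, ∀ C ∈ P.parts, B ≠ C →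
    ∀ a ∈ B, ∀ b ∈ B, ∀ c ∈ C, ∀ d ∈ C, ¬ (a < c ∧ c < b ∧ b < d)

/-- The noncrossing permutations of `[n]`, as permutations of `ℕ` fixing all `i ≥ n`. -/
def noncrossingPerms (n : ℕ) : Set (Equiv.Perm ℕ) :=
  {σ | ∃ P : Finpartition (Finset.range n), IsNoncrossing P ∧ σ = blocksPerm P.parts.toList}

/-! ### Indexed forests -/

/-- An indexed forest: a sequence of binary plane trees, all but finitely many of them trivial.
`BinaryTree.nil` is the trivial tree (a leaf), `BinaryTree.node` an internal node. -/
structure IndexedForest where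
  tree : ℕ → BinaryTree Unit
  finite_nontrivial : {i | tree i ≠ BinaryTree.nil}.Finite

namespace IndexedForest

/-- The empty forest, all of whose trees are trivial. -/
def empty : IndexedForest where
  tree _ := BinaryTree.nil
  finite_nontrivial := by simp

instance : Nonempty IndexedForest := ⟨empty⟩

/-- The label of the leftmost leaf of the `i`-th tree, the leaves of the forest being labelled
by `0, 1, 2, …` from left to right. -/
def start (F : IndexedForest) (i : ℕ) : ℕ :=
  ∑ j ∈ Finset.range i, (F.tree j).numLeaves

/-- The labels of the leaves of the nontrivial trees. -/
def supp (F : IndexedForest) : Set ℕ :=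
  {k | ∃ i, F.tree i ≠ BinaryTree.nil ∧ F.start i ≤ k ∧ k < F.start i + (F.tree i).numLeaves}

end IndexedForest

/-- The forests supported on `[n]`. -/
def forestsOn (n : ℕ) : Set IndexedForest := {F | F.supp ⊆ {k | k < n}}

/-- For a tree with leaves `k, k + 1, …`, the labels of the left children of its terminal nodes
(the internal nodes both of whose children are leaves). -/
def terminalLabels : BinaryTree Unit → ℕ → Set ℕ
  | .nil, _ => ∅
  | .node _ l r, k =>
      {i | l = .nil ∧ r = .nil ∧ i = k} ∪ terminalLabels l k ∪ terminalLabels r (k + l.numLeaves)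

/-- For a tree with leaves `k, k + 1, …`, delete the terminal node whose left child is
the leaf `i` (turning it into a leaf), if there is one. -/
def trimTree (i : ℕ) : BinaryTree Unit → ℕ → BinaryTree Unit
  | .nil, _ => .nil
  | .node _ l r, k =>
      if l = .nil ∧ r = .nil ∧ i = k then .nil
      else .node () (trimTree i l k) (trimTree i r (k + l.numLeaves))

namespace IndexedForest

/-- The set `QDes(F)` of the labels of the leaves reached from the terminal nodes of `F`
by going down left edges. -/
def qDes (F : IndexedForest) : Set ℕ := {i | ∃ j, i ∈ terminalLabels (F.tree j) (F.start j)}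

/-- The trimmed forest `F / i`, for `i ∈ QDes(F)`: delete the terminal node of `F` whose
left child is the leaf `i`. -/
def trim (F : IndexedForest) (i : ℕ) : IndexedForest where
  tree j := trimTree i (F.tree j) (F.start j)
  finite_nontrivial := by
    refine F.finite_nontrivial.subset fun j hj h => hj ?_
    simp [h, trimTree]

end IndexedForest

/-! ### From forests to noncrossing permutations -/

/-- Binary plane trees with labelled leaves: the trees of nested forests. -/
inductive LabelledTree where
  | leaf (a : ℕ) : LabelledTree
  | node (l r : LabelledTree) : LabelledTree

/-- The set of leaf labels. -/
def LabelledTree.leaves : LabelledTree → Finset ℕ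
  | .leaf a => {a}
  | .node l r => l.leaves ∪ r.leaves

/-- Label the leaves of a tree by `k, k + 1, …` from left to right. -/
def labelTree : BinaryTree Unit → ℕ → LabelledTree
  | .nil, k => .leaf k
  | .node _ l r, k => .node (labelTree l k) (labelTree r (k + l.numLeaves))

/-- Delete the left edge of every internal node that is a right child. The first argument says
whether the root of the given subtree is itself a right child. The result consists of the tree
that takes the place of the given one and the list of the trees that have been cut off:
if an internal node `v` is a right child, then its left subtree is cut off, `v` is deleted, and
its right child takes the place of `v`. -/
def cutLeftEdges : Bool → LabelledTree → LabelledTree × List LabelledTree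
  | _, .leaf a => (.leaf a, [])
  | false, .node l r =>
      (.node (cutLeftEdges false l).1 (cutLeftEdges true r).1,
        (cutLeftEdges false l).2 ++ (cutLeftEdges true r).2)
  | true, .node l r =>
      ((cutLeftEdges true r).1,
        (cutLeftEdges false l).1 :: ((cutLeftEdges false l).2 ++ (cutLeftEdges true r).2))

namespace IndexedForest

/-- The trees of the nested forest `LC(F)` that come from the `i`-th tree of `F`. -/
def lcTrees (F : IndexedForest) (i : ℕ) : List LabelledTree :=
  (cutLeftEdges false (labelTree (F.tree i) (F.start i))).1 ::
    (cutLeftEdges false (labelTree (F.tree i) (F.start i))).2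

/-- The blocks contained in `[n]` of the noncrossing partition given by the leaf sets of the trees
of `LC(F)`. As all leaves of the `i`-th tree of `F` are at least `i`, these blocks come from
the first `n` trees. -/
def lcBlocks (n : ℕ) (F : IndexedForest) : List (Finset ℕ) :=
  (((List.range n).flatMap F.lcTrees).map LabelledTree.leaves).filter (· ⊆ Finset.range n)

/-- The map `ForToNC` from forests supported on `[n]` to noncrossing permutations of `[n]`. -/
def forToNC (n : ℕ) (F : IndexedForest) : Equiv.Perm ℕ := blocksPerm (F.lcBlocks n)

end IndexedForest

/-! ### Double forest polynomials -/

noncomputable section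

open MvPolynomial

/-- The ring `ℤ[t][x]`, as the polynomials in the variables `x i` and `t i` for `i : ℕ`. -/
abbrev PolTX : Type := MvPolynomial (ℕ ⊕ ℕ) ℤ

/-- The variable `x_i`. -/
def x (i : ℕ) : PolTX := X (Sum.inl i)

/-- The variable `t_i`. -/
def t (i : ℕ) : PolTX := X (Sum.inr i)

/-- `R_i^- f = f(x_1, …, x_{i-1}, t_i, x_i, x_{i+1}, …; t)`. -/
def bergeronSottileMinus (i : ℕ) : PolTX →ₐ[ℤ] PolTX :=
  aeval (Sum.elim (fun j => if j < i then x j else if j = i then t i else x (j - 1)) t)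

/-- `R_i^+ f = f(x_1, …, x_{i-1}, x_i, t_i, x_{i+1}, …; t)`. -/
def bergeronSottilePlus (i : ℕ) : PolTX →ₐ[ℤ] PolTX :=
  aeval (Sum.elim (fun j => if j ≤ i then x j else if j = i + 1 then t i else x (j - 1)) t)

theorem sub_dvd_bergeronSottile_sub (i : ℕ) (f : PolTX) :
    x i - t i ∣ bergeronSottilePlus i f - bergeronSottileMinus i f := by
  rw [← Ideal.mem_span_singleton, ← Ideal.Quotient.mk_eq_mk_iff_sub_mem]
  have hxt : Ideal.Quotient.mkₐ ℤ (Ideal.span {x i - t i}) (x i) =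
      Ideal.Quotient.mkₐ ℤ (Ideal.span {x i - t i}) (t i) := by
    simp only [Ideal.Quotient.mkₐ_eq_mk]
    rw [Ideal.Quotient.mk_eq_mk_iff_sub_mem]
    exact Ideal.mem_span_singleton_self _
  have h : (Ideal.Quotient.mkₐ ℤ (Ideal.span {x i - t i})).comp (bergeronSottilePlus i) =
      (Ideal.Quotient.mkₐ ℤ (Ideal.span {x i - t i})).comp (bergeronSottileMinus i) := by
    apply MvPolynomial.algHom_ext
    rintro (j | j)
    · simp only [AlgHom.comp_apply, bergeronSottilePlus, bergeronSottileMinus, aeval_X,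
        Sum.elim_inl]
      rcases lt_trichotomy j i with hj | hj | hj
      · simp [hj, hj.le]
      · subst hj
        simpa using hxt
      · rcases eq_or_ne j (i + 1) with rfl | hj'
        · simpa using hxt.symm
        · simp [hj.not_gt, hj.not_ge, hj.ne', hj']
    · simp [bergeronSottilePlus, bergeronSottileMinus]
  exact DFunLike.congr_fun h f

/-- The equivariant trimming operation `E_i f = (R_i^+ f - R_i^- f) / (x_i - t_i)`. -/
def equivariantTrim (i : ℕ) (f : PolTX) : PolTX :=
  (sub_dvd_bergeronSottile_sub i f).choose

theorem mul_equivariantTrim (i : ℕ) (f : PolTX) :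
    (x i - t i) * equivariantTrim i f = bergeronSottilePlus i f - bergeronSottileMinus i f :=
  (sub_dvd_bergeronSottile_sub i f).choose_spec.symm

/-- The evaluation `ev_σ f = f(t_{σ(1)}, t_{σ(2)}, …; t)`, with values in `ℤ[t]`. -/
def ev (σ : Equiv.Perm ℕ) : PolTX →ₐ[ℤ] MvPolynomial ℕ ℤ :=
  aeval (Sum.elim (fun i => X (σ i)) X)

/-- The substitution `f(x; t) ↦ f(x; t_1, …, t_{i-1}, t_{i+1}, …)` that skips `t_i`. -/
def omitT (i : ℕ) : PolTX →ₐ[ℤ] PolTX :=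
  aeval (Sum.elim x (fun j => if j < i then t j else t (j + 1)))

open Classical in
/-- The defining properties of the family of double forest polynomials: homogeneity,
`P_F(t; t) = δ_{F, ∅}`, and `E_i P_F` is `P_{F / i}(x; t_1, …, t_{i-1}, t_{i+1}, …)` for
`i ∈ QDes(F)` and `0` otherwise. -/
structure IsDoubleForestFamily (P : IndexedForest → PolTX) : Prop where
  homogeneous : ∀ F, ∃ d, (P F).IsHomogeneous d
  normalized : ∀ F, ev 1 (P F) = if F = IndexedForest.empty then 1 else 0
  trimming : ∀ F i, equivariantTrim i (P F) = if i ∈ F.qDes then omitT i (P (F.trim i)) else 0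

/-- The double forest polynomials: the family with the defining properties
`IsDoubleForestFamily`. (That there is exactly one such family is part of the theorem.) -/
def doubleForestPoly : IndexedForest → PolTX := Classical.epsilon IsDoubleForestFamily

end

end DoubleForest

open DoubleForest

/-! Everything rests on one way of building permutations: insert a new letter `i` into the one-line
form of `σ`, at position `i` or `i + 1`, after moving up the old letters from `i` on. The two
results differ by the adjacent transposition at `i`; `insertDesc i σ` is the one with a descent
there, `insertAsc i σ` the one with an ascent. The operation `E_i` compares precisely these two
insertions at the level of variables, so evaluating its defining equation gives `ev_insertDesc`: the
value of `P_F` at `insertDesc i σ` is its value at `insertAsc i σ`, plus, if `i ∈ QDes(F)`, a factor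
`t_b - t_a` with `a < b` times the value of `P_{F/i}` at `σ` with its parameters renumbered.

Forests and noncrossing permutations obey the same recursion. Grafting a terminal node on leaf `i`
turns the permutation of the forest into its `insertDesc i` (`perm_graft`), and a position with `i ≤
π i` and `π (i + 1) ≤ i` betrays a terminal node (`mem_qDes_of_perm`). Every noncrossing permutation
other than the identity has such a position and is `insertDesc i τ` for a noncrossing `τ` on one
letter less; `insertAsc i τ` is noncrossing as well and has smaller ranks. This gives the bijection
and the induction principle `IsNC.induction`.

The order is handled through `RankLE`, which compares only the ranks at `(b, b)` and `(b + 1, b)`.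
The two insertions differ there in at most the entries `(i + 1, i)` and `(i + 1, i + 1)`. Hence
`insertDesc i` preserves and reflects `RankLE`, and whatever lies below `insertDesc i σ` but not
below `insertAsc i σ` has a descent across `i` (`RankLE.insertAsc_or`). With these facts the
induction shows that `ev_σ P_F` vanishes unless `RankLE F.perm σ`, and otherwise is positive at
every strictly increasing integer sequence; positivity rules out cancellation between the two terms
of the recursion. The same induction, appending the letter `i` to words, shows that `RankLE` is the
Bruhat order here (`IsNC.bruhatLE_iff`); the converse is the usual monotonicity of ranks under
subwords.

For existence of the polynomials one solves `E_i f = g_i` for all `i` at once. The `g_i` must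
satisfy the relation of `insertT_equivariantTrim`, which the recursion provides because trimmings of
forests commute; the system is then solved from large `i` downwards. For uniqueness, a polynomial
killed by all `E_i` involves only the `t_j`, so its value at `x = t` determines it. -/

namespace DoubleForest

open MvPolynomial

/-! ### Substituting an equivariant parameter for one of the variables -/

noncomputable section

/-- The substitution `f ↦ f(x_0, …, x_{i-1}, t_a, x_i, x_{i+1}, …; t)`. -/
def insertT (i a : ℕ) : PolTX →ₐ[ℤ] PolTX :=
  aeval (Sum.elim (fun j => if j < i then x j else if j = i then t a else x (j - 1)) t)

end

theorem insertT_x (i a j : ℕ) :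
    insertT i a (x j) = if j < i then x j else if j = i then t a else x (j - 1) := by
  simp [insertT, x]

@[simp] theorem insertT_t (i a j : ℕ) : insertT i a (t j) = t j := by
  simp [insertT, t]

theorem insertT_x_of_lt {i j : ℕ} (a : ℕ) (h : j < i) : insertT i a (x j) = x j := by
  simp [insertT_x, h]

@[simp] theorem insertT_x_self (i a : ℕ) : insertT i a (x i) = t a := by
  simp [insertT_x]

theorem insertT_x_succ_of_le {i j : ℕ} (a : ℕ) (h : i ≤ j) : insertT i a (x (j + 1)) = x j := by
  rw [insertT_x, if_neg (by omega), if_neg (by omega)]; rfl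

theorem bergeronSottileMinus_eq (i : ℕ) : bergeronSottileMinus i = insertT i i := rfl

theorem bergeronSottilePlus_eq (i : ℕ) : bergeronSottilePlus i = insertT (i + 1) i := by
  unfold bergeronSottilePlus insertT
  simp only [Nat.lt_succ_iff]

theorem algHom_ext_xt {A : Type*} [CommRing A] [Algebra ℤ A] {f g : PolTX →ₐ[ℤ] A}
    (hx : ∀ j, f (x j) = g (x j)) (ht : ∀ j, f (t j) = g (t j)) : f = g :=
  MvPolynomial.algHom_ext (Sum.forall.2 ⟨hx, ht⟩)

theorem insertT_insertT {p q : ℕ} (hpq : p ≤ q) (a b : ℕ) (f : PolTX) :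
    insertT p a (insertT (q + 1) b f) = insertT q b (insertT p a f) := by
  have h : (insertT p a).comp (insertT (q + 1) b) = (insertT q b).comp (insertT p a) := by
    apply algHom_ext_xt
    · intro j
      simp only [AlgHom.comp_apply, insertT_x]
      rcases lt_trichotomy j p with h | rfl | h
      · rw [if_pos (by omega), if_pos h, insertT_x, insertT_x, if_pos h, if_pos (by omega)]
      · rw [if_pos (by omega), if_neg (by omega), if_pos rfl, insertT_x_self, insertT_t]
      · obtain ⟨j, rfl⟩ : ∃ k, j = k + 1 := ⟨j - 1, by omega⟩
        rw [if_neg (by omega : ¬ j + 1 < p), if_neg (by omega : ¬ j + 1 = p)]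
        simp only [Nat.add_lt_add_iff_right, Nat.add_right_cancel_iff, Nat.add_sub_cancel]
        rcases lt_trichotomy j q with h' | rfl | h'
        · rw [if_pos h', insertT_x_succ_of_le _ (by omega), insertT_x_of_lt _ h']
        · simp
        · obtain ⟨j, rfl⟩ : ∃ k, j = k + 1 := ⟨j - 1, by omega⟩
          rw [if_neg (by omega), if_neg (by omega), insertT_x_succ_of_le _ (by omega),
            insertT_x_succ_of_le _ (by omega)]
    · simp
  exact DFunLike.congr_fun h f

/-! ### Polynomials in the first few variables `x` -/

/-- The polynomials that only involve the variables `x_j` with `j < k`, and all `t_j`. -/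
noncomputable def firstVars (k : ℕ) : Subalgebra ℤ PolTX :=
  supported ℤ {v | ∀ j, v = Sum.inl j → j < k}

theorem x_mem_firstVars {j k : ℕ} (h : j < k) : x j ∈ firstVars k :=
  X_mem_supported.2 (by rintro _ ⟨rfl⟩; exact h)

theorem t_mem_firstVars (j k : ℕ) : t j ∈ firstVars k :=
  X_mem_supported.2 (by simp)

theorem firstVars_mono : Monotone firstVars := fun _ _ h =>
  supported_mono fun _ hv j hj => (hv j hj).trans_le h

theorem exists_mem_firstVars (f : PolTX) : ∃ k, f ∈ firstVars k := by
  obtain ⟨k, hk⟩ := (f.vars.image (Sum.elim id fun _ => 0)).bddAbove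
  refine ⟨k + 1, mem_supported.2 fun v hv j hj => Nat.lt_succ_of_le (hk ?_)⟩
  simp only [Finset.coe_image, Set.mem_image]
  exact ⟨v, hv, by simp [hj]⟩

theorem algHom_eq_of_mem_firstVars {A : Type*} [CommRing A] [Algebra ℤ A] {φ ψ : PolTX →ₐ[ℤ] A}
    {k : ℕ} (hx : ∀ j < k, φ (x j) = ψ (x j)) (ht : ∀ j, φ (t j) = ψ (t j)) {f : PolTX}
    (hf : f ∈ firstVars k) : φ f = ψ f := by
  have : firstVars k ≤ AlgHom.equalizer φ ψ := by
    refine Algebra.adjoin_le ?_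
    rintro _ ⟨j | j, hv, rfl⟩
    · exact hx j (hv j rfl)
    · exact ht j
  exact this hf

theorem algHom_mem_firstVars {φ : PolTX →ₐ[ℤ] PolTX} {k l : ℕ}
    (hx : ∀ j < k, φ (x j) ∈ firstVars l) (ht : ∀ j, φ (t j) ∈ firstVars l) {f : PolTX}
    (hf : f ∈ firstVars k) : φ f ∈ firstVars l := by
  have : firstVars k ≤ (firstVars l).comap φ := by
    refine Algebra.adjoin_le ?_
    rintro _ ⟨j | j, hv, rfl⟩
    · exact hx j (hv j rfl)
    · exact ht j
  exact this hf

theorem insertT_of_mem_firstVars {k i : ℕ} (h : k ≤ i) (a : ℕ) {f : PolTX}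
    (hf : f ∈ firstVars k) : insertT i a f = f :=
  algHom_eq_of_mem_firstVars (ψ := AlgHom.id ℤ PolTX)
    (fun _ hj => insertT_x_of_lt a (hj.trans_le h)) (fun _ => insertT_t _ _ _) hf

/-- Inserting at `m + 1` does nothing to such an `f`, while inserting at `m` replaces `x m` by `t
a`; equality therefore rewrites `f` without `x m`. -/
theorem mem_firstVars_of_insertT_eq {m a : ℕ} {f : PolTX} (hf : f ∈ firstVars (m + 1))
    (h : insertT (m + 1) a f = insertT m a f) : f ∈ firstVars m := by
  rw [insertT_of_mem_firstVars le_rfl a hf] at h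
  rw [h]
  refine algHom_mem_firstVars (fun j hj => ?_) (fun j => by simpa using t_mem_firstVars _ _) hf
  rcases Nat.lt_succ_iff_lt_or_eq.1 hj with hj | rfl
  · rw [insertT_x_of_lt _ hj]; exact x_mem_firstVars hj
  · rw [insertT_x_self]; exact t_mem_firstVars _ _

/-- Only finitely many variables occur, so they can be stripped off one by one from the top. The
inserted parameter may vary with `m`: it is `t m` for the kernel of the trimmings and `t (m + 1)`
for the integrability argument. -/
theorem mem_firstVars_of_forall_insertT_eq {k : ℕ} (a : ℕ → ℕ) {f : PolTX}
    (h : ∀ m, k ≤ m → insertT (m + 1) (a m) f = insertT m (a m) f) : f ∈ firstVars k := by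
  obtain ⟨n, hn⟩ := exists_mem_firstVars f
  have key : ∀ d, f ∈ firstVars (k + d) → f ∈ firstVars k := by
    intro d
    induction d with
    | zero => exact id
    | succ d ih => exact fun hd => ih (mem_firstVars_of_insertT_eq hd (h _ (Nat.le_add_right _ _)))
  exact key n (firstVars_mono (Nat.le_add_left _ _) hn)

/-! ### The equivariant trimming operations -/

theorem x_sub_t_ne_zero (i j : ℕ) : x i - t j ≠ 0 := by
  simp [x, t, sub_eq_zero, X_inj]

theorem sub_mul_equivariantTrim (i : ℕ) (f : PolTX) :
    (x i - t i) * equivariantTrim i f = insertT (i + 1) i f - insertT i i f := by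
  rw [mul_equivariantTrim, bergeronSottilePlus_eq, bergeronSottileMinus_eq]

/-- The quotient is merely chosen, but `x i - t i` can be cancelled, so the defining equation
characterizes it. -/
theorem equivariantTrim_eq_iff {i : ℕ} {f g : PolTX} :
    equivariantTrim i f = g ↔ insertT (i + 1) i f - insertT i i f = (x i - t i) * g := by
  rw [← sub_mul_equivariantTrim, mul_right_inj' (x_sub_t_ne_zero i i)]

theorem equivariantTrim_eq_zero_iff {i : ℕ} {f : PolTX} :
    equivariantTrim i f = 0 ↔ insertT (i + 1) i f = insertT i i f := by
  rw [equivariantTrim_eq_iff, mul_zero, sub_eq_zero]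

theorem equivariantTrim_add (i : ℕ) (f g : PolTX) :
    equivariantTrim i (f + g) = equivariantTrim i f + equivariantTrim i g := by
  rw [equivariantTrim_eq_iff, mul_add, sub_mul_equivariantTrim, sub_mul_equivariantTrim, map_add,
    map_add]
  ring

theorem equivariantTrim_sub (i : ℕ) (f g : PolTX) :
    equivariantTrim i (f - g) = equivariantTrim i f - equivariantTrim i g := by
  rw [equivariantTrim_eq_iff, mul_sub, sub_mul_equivariantTrim, sub_mul_equivariantTrim, map_sub,
    map_sub]
  ring

theorem equivariantTrim_of_mem_firstVars {k i : ℕ} (h : k ≤ i) {f : PolTX}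
    (hf : f ∈ firstVars k) : equivariantTrim i f = 0 := by
  rw [equivariantTrim_eq_zero_iff, insertT_of_mem_firstVars (by omega) _ hf,
    insertT_of_mem_firstVars h _ hf]

/-- Insertion at `k + 1` fixes the product and insertion at `k` kills it. This right inverse of
`E_k` leaves all `E_i` with `i > k` undisturbed, since the product involves only `x_0, …, x_k`. -/
theorem equivariantTrim_sub_mul {k : ℕ} {f : PolTX} (hf : f ∈ firstVars (k + 1)) :
    equivariantTrim k ((x k - t k) * f) = f := by
  rw [equivariantTrim_eq_iff, map_mul, map_mul, insertT_of_mem_firstVars le_rfl _ hf]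
  simp [insertT_x_of_lt]

/-- A polynomial killed by all equivariant trimming operations does not involve the `x_j`. -/
theorem mem_firstVars_zero_of_equivariantTrim {f : PolTX} (h : ∀ i, equivariantTrim i f = 0) :
    f ∈ firstVars 0 :=
  mem_firstVars_of_forall_insertT_eq id fun i _ => equivariantTrim_eq_zero_iff.1 (h i)

theorem rename_ev_one_of_mem {f : PolTX} (hf : f ∈ firstVars 0) :
    rename Sum.inr (ev 1 f) = f := by
  refine algHom_eq_of_mem_firstVars (φ := (rename Sum.inr).comp (ev 1))
    (ψ := AlgHom.id ℤ PolTX) (by simp) (fun j => ?_) hf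
  simp [ev, t]

theorem rename_inr_mem (f : MvPolynomial ℕ ℤ) : (rename Sum.inr f : PolTX) ∈ firstVars 0 := by
  refine mem_supported.2 fun v hv j hj => ?_
  have := vars_rename Sum.inr f hv
  simp [hj] at this

theorem ev_one_rename (f : MvPolynomial ℕ ℤ) : ev 1 (rename Sum.inr f) = f := by
  rw [ev, aeval_rename]
  simp

theorem eq_zero_of_equivariantTrim {f : PolTX} (h : ∀ i, equivariantTrim i f = 0)
    (h1 : ev 1 f = 0) : f = 0 := by
  rw [← rename_ev_one_of_mem (mem_firstVars_zero_of_equivariantTrim h), h1, map_zero]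

/-- The commutation relation of the equivariant trimming operations at distance at least two. -/
theorem insertT_equivariantTrim {i m : ℕ} (h : i < m) (f : PolTX) :
    insertT (m + 1) (m + 1) (equivariantTrim i f) - insertT m (m + 1) (equivariantTrim i f) =
      (x m - t (m + 1)) * equivariantTrim i (equivariantTrim (m + 1) f) := by
  -- Cleared of denominators, both sides are alternating sums over the four ways of inserting `t i`
  -- at `i` or `i + 1` and `t (m + 1)` at the place of `m` or `m + 1`; they differ only in the order
  -- of the two insertions.
  apply mul_left_cancel₀ (x_sub_t_ne_zero i i)
  have h1 : ∀ p, i < p → ∀ g, (x i - t i) * insertT p (m + 1) (equivariantTrim i g) =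
      insertT p (m + 1) (insertT (i + 1) i g - insertT i i g) := by
    intro p hp g
    rw [← sub_mul_equivariantTrim, map_mul, map_sub, insertT_t, insertT_x_of_lt _ hp]
  have h2 : ∀ p, p ≤ m → ∀ g, (x m - t (m + 1)) * insertT p i (equivariantTrim (m + 1) g) =
      insertT p i (insertT (m + 2) (m + 1) g - insertT (m + 1) (m + 1) g) := by
    intro p hp g
    rw [← sub_mul_equivariantTrim, map_mul, map_sub, insertT_t, insertT_x_succ_of_le _ hp]
  rw [mul_sub, h1 _ (by omega), h1 _ h, mul_left_comm, sub_mul_equivariantTrim, mul_sub,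
    h2 _ (by omega), h2 _ h.le]
  simp only [map_sub]
  rw [insertT_insertT (p := i + 1) (q := m + 1) (by omega),
    insertT_insertT (p := i + 1) (q := m) (by omega),
    insertT_insertT (p := i) (q := m + 1) (by omega), insertT_insertT (p := i) (q := m) (by omega)]
  ring

/-! ### Homogeneity -/

theorem isHomogeneous_x (i : ℕ) : (x i).IsHomogeneous 1 := isHomogeneous_X _ _

theorem isHomogeneous_t (i : ℕ) : (t i).IsHomogeneous 1 := isHomogeneous_X _ _

theorem isHomogeneous_x_sub_t (i j : ℕ) : (x i - t j).IsHomogeneous 1 :=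
  (isHomogeneous_x i).sub (isHomogeneous_t j)

theorem isHomogeneous_insertT (i a : ℕ) {f : PolTX} {d : ℕ} (hf : f.IsHomogeneous d) :
    (insertT i a f).IsHomogeneous d := by
  rw [← one_mul d]
  refine hf.aeval _ ?_
  rintro (j | j)
  · simp only [Sum.elim_inl]
    split_ifs
    exacts [isHomogeneous_x _, isHomogeneous_t _, isHomogeneous_x _]
  · exact isHomogeneous_t _

theorem isHomogeneous_omitT (i : ℕ) {f : PolTX} {d : ℕ} (hf : f.IsHomogeneous d) :
    (omitT i f).IsHomogeneous d := by
  rw [← one_mul d]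
  refine hf.aeval _ ?_
  rintro (j | j)
  · exact isHomogeneous_x _
  · simp only [Sum.elim_inr]
    split_ifs
    exacts [isHomogeneous_t _, isHomogeneous_t _]

theorem isHomogeneous_ev (σ : Equiv.Perm ℕ) {f : PolTX} {d : ℕ} (hf : f.IsHomogeneous d) :
    (ev σ f).IsHomogeneous d := by
  rw [← one_mul d]
  refine hf.aeval _ ?_
  rintro (j | j)
  · exact isHomogeneous_X _ _
  · exact isHomogeneous_X _ _

theorem isHomogeneous_of_mul_left {τ : Type*} {p q : MvPolynomial τ ℤ} {d e : ℕ}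
    (hp : p.IsHomogeneous e) (hp0 : p ≠ 0) (h : (p * q).IsHomogeneous (e + d)) :
    q.IsHomogeneous d := by
  let := MvPolynomial.gradedAlgebra (σ := τ) (R := ℤ)
  have key := DirectSum.coe_decompose_mul_add_of_left_mem (homogeneousSubmodule τ ℤ)
    (i := e) (j := d) (b := q) ((mem_homogeneousSubmodule _ _).2 hp)
  rw [DirectSum.decompose_of_mem_same _ ((mem_homogeneousSubmodule _ _).2 h)] at key
  rw [mul_left_cancel₀ hp0 key]
  exact (mem_homogeneousSubmodule _ _).1 (SetLike.coe_mem _)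

theorem isHomogeneous_equivariantTrim (i : ℕ) {f : PolTX} {d : ℕ} (hf : f.IsHomogeneous (d + 1)) :
    (equivariantTrim i f).IsHomogeneous d := by
  refine isHomogeneous_of_mul_left (isHomogeneous_x_sub_t i i) (x_sub_t_ne_zero i i) ?_
  rw [sub_mul_equivariantTrim, add_comm 1 d]
  exact (isHomogeneous_insertT _ _ hf).sub (isHomogeneous_insertT _ _ hf)

/-! ### Inverting the equivariant trimming operations -/

/-- Downward induction: a solution for all indices above `k` is corrected by a multiple of `x k - t
k` so as to be right at `k` too. The hypothesis `hg` is the relation that trimmings of a single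
polynomial satisfy, and it bounds the variables of the error. -/
theorem exists_equivariantTrim_eq_of_le {g : ℕ → PolTX} {N d : ℕ} (hN : ∀ i, N ≤ i → g i = 0)
    (hd : ∀ i, (g i).IsHomogeneous d)
    (hg : ∀ i m, i < m → insertT (m + 1) (m + 1) (g i) - insertT m (m + 1) (g i) =
      (x m - t (m + 1)) * equivariantTrim i (g (m + 1))) {k : ℕ} (hk : k ≤ N) :
    ∃ f : PolTX, f.IsHomogeneous (d + 1) ∧ ∀ i, k ≤ i → equivariantTrim i f = g i := by
  induction hk using Nat.decreasingInduction with
  | self =>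
    refine ⟨0, isHomogeneous_zero _ _ _, fun i hi => ?_⟩
    rw [hN i hi, equivariantTrim_eq_zero_iff, map_zero, map_zero]
  | of_succ k _ ih =>
    obtain ⟨f, hfd, hf⟩ := ih
    -- For `m > k` the error `g k - E_k f` cannot tell an insertion at `m + 1` from one at `m`: both
    -- terms satisfy the same relation, and `f` already solves the equation at `m + 1`.
    have hmem : g k - equivariantTrim k f ∈ firstVars (k + 1) := by
      refine mem_firstVars_of_forall_insertT_eq (· + 1) fun m hm => ?_
      rw [← sub_eq_zero, map_sub, map_sub, sub_sub_sub_comm, hg k m hm,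
        insertT_equivariantTrim hm, hf (m + 1) (by omega), sub_self]
    refine ⟨f + (x k - t k) * (g k - equivariantTrim k f), ?_, fun i hi => ?_⟩
    · refine hfd.add ?_
      rw [add_comm d 1]
      exact (isHomogeneous_x_sub_t k k).mul ((hd k).sub (isHomogeneous_equivariantTrim k hfd))
    · rw [equivariantTrim_add]
      rcases hi.eq_or_lt with rfl | hi
      · rw [equivariantTrim_sub_mul hmem, add_sub_cancel]
      · rw [hf i hi, equivariantTrim_of_mem_firstVars hi, add_zero]
        exact mul_mem (sub_mem (x_mem_firstVars (Nat.lt_succ_self k)) (t_mem_firstVars _ _)) hmem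

theorem exists_equivariantTrim_eq {g : ℕ → PolTX} {N d : ℕ} (hN : ∀ i, N ≤ i → g i = 0)
    (hd : ∀ i, (g i).IsHomogeneous d)
    (hg : ∀ i m, i < m → insertT (m + 1) (m + 1) (g i) - insertT m (m + 1) (g i) =
      (x m - t (m + 1)) * equivariantTrim i (g (m + 1))) :
    ∃ f : PolTX, f.IsHomogeneous (d + 1) ∧ ev 1 f = 0 ∧ ∀ i, equivariantTrim i f = g i := by
  obtain ⟨f, hfd, hf⟩ := exists_equivariantTrim_eq_of_le hN hd hg (Nat.zero_le N)
  -- Subtracting a polynomial in the `t_j` alone normalizes the value at `x = t` without changing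
  -- any trimming.
  refine ⟨f - rename Sum.inr (ev 1 f), hfd.sub ((isHomogeneous_ev 1 hfd).rename_isHomogeneous), ?_,
    fun i => ?_⟩
  · rw [map_sub, ev_one_rename, sub_self]
  · rw [equivariantTrim_sub, hf i (Nat.zero_le i),
      equivariantTrim_of_mem_firstVars (Nat.zero_le i) (rename_inr_mem _), sub_zero]

/-! ### Omitting one of the parameters -/

/-- The increasing enumeration of `ℕ \ {i}`. -/
def skip (i k : ℕ) : ℕ := if k < i then k else k + 1

theorem skip_of_lt {i k : ℕ} (h : k < i) : skip i k = k := if_pos h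

theorem skip_of_le {i k : ℕ} (h : i ≤ k) : skip i k = k + 1 := if_neg h.not_gt

@[simp] theorem omitT_x (i j : ℕ) : omitT i (x j) = x j := by
  simp [omitT, x]

theorem omitT_t (i j : ℕ) : omitT i (t j) = t (skip i j) := by
  simp only [omitT, t, aeval_X, Sum.elim_inr, skip]
  split_ifs <;> rfl

theorem omitT_omitT {i m : ℕ} (h : i ≤ m) (f : PolTX) :
    omitT (m + 1) (omitT i f) = omitT i (omitT m f) := by
  have : (omitT (m + 1)).comp (omitT i) = (omitT i).comp (omitT m) := by
    apply algHom_ext_xt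
    · simp
    · intro j
      simp only [AlgHom.comp_apply, omitT_t]
      congr 1
      unfold skip
      split_ifs <;> omega
  exact DFunLike.congr_fun this f

theorem insertT_omitT (p i a : ℕ) (f : PolTX) :
    insertT p (skip i a) (omitT i f) = omitT i (insertT p a f) := by
  have : (insertT p (skip i a)).comp (omitT i) = (omitT i).comp (insertT p a) := by
    apply algHom_ext_xt
    · intro j
      simp only [AlgHom.comp_apply, omitT_x, insertT_x]
      split_ifs <;> simp [omitT_t]
    · intro j
      simp [omitT_t]
  exact DFunLike.congr_fun this f

theorem equivariantTrim_omitT {i j : ℕ} (h : i < j) (f : PolTX) :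
    equivariantTrim i (omitT j f) = omitT j (equivariantTrim i f) := by
  have h1 : t i = omitT j (t i) := by rw [omitT_t, skip_of_lt h]
  have h2 : ∀ p, insertT p i (omitT j f) = omitT j (insertT p i f) := fun p => by
    conv_lhs => rw [← skip_of_lt h, insertT_omitT]
  rw [equivariantTrim_eq_iff, h2, h2, ← map_sub, ← sub_mul_equivariantTrim, map_mul, map_sub,
    omitT_x, ← h1]

/-- Omitting `t i` renames `t m` to `t (m + 1)`, so the difference in the integrability relation is
itself a trimming at `m`. -/
theorem insertT_sub_insertT_omitT {i m : ℕ} (h : i ≤ m) (f : PolTX) :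
    insertT (m + 1) (m + 1) (omitT i f) - insertT m (m + 1) (omitT i f) =
      (x m - t (m + 1)) * omitT i (equivariantTrim m f) := by
  have h1 : t (m + 1) = omitT i (t m) := by rw [omitT_t, skip_of_le h]
  have h2 : ∀ p, insertT p (m + 1) (omitT i f) = omitT i (insertT p m f) := fun p => by
    conv_lhs => rw [← skip_of_le h, insertT_omitT]
  rw [h2, h2, ← map_sub, ← sub_mul_equivariantTrim, map_mul, map_sub, omitT_x, ← h1]

/-! ### Grafting a terminal node on a leaf of a tree -/

theorem numLeaves_node (l r : BinaryTree Unit) :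
    (BinaryTree.node () l r).numLeaves = l.numLeaves + r.numLeaves := rfl

theorem numLeaves_nil : (BinaryTree.nil : BinaryTree Unit).numLeaves = 1 := rfl

/-- Replace the `i`-th leaf of a tree by a terminal node. -/
def graftTree : BinaryTree Unit → ℕ → BinaryTree Unit
  | .nil, 0 => .node () .nil .nil
  | .nil, _ + 1 => .nil
  | .node _ l r, i =>
      if i < l.numLeaves then .node () (graftTree l i) r
      else .node () l (graftTree r (i - l.numLeaves))

theorem graftTree_node_of_lt {l r : BinaryTree Unit} {i : ℕ} (h : i < l.numLeaves) :
    graftTree (.node () l r) i = .node () (graftTree l i) r := by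
  simp [graftTree, h]

theorem graftTree_node_add (l r : BinaryTree Unit) (i : ℕ) :
    graftTree (.node () l r) (l.numLeaves + i) = .node () l (graftTree r i) := by
  simp [graftTree]

/-- Out-of-range indices leave a tree alone, so a forest can be grafted by the same formula on all
trees that start at or before the leaf. -/
theorem graftTree_of_le {T : BinaryTree Unit} {i : ℕ} (h : T.numLeaves ≤ i) :
    graftTree T i = T := by
  induction T generalizing i with
  | nil =>
    obtain ⟨i, rfl⟩ := Nat.exists_eq_add_of_lt (show 0 < i from h)
    simp [graftTree]
  | node _ l r _ ihr =>
    rw [numLeaves_node] at h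
    obtain ⟨i, rfl⟩ := Nat.exists_eq_add_of_le (show l.numLeaves ≤ i by omega)
    rw [graftTree_node_add, ihr (by omega)]

theorem numLeaves_graftTree {T : BinaryTree Unit} {i : ℕ} (h : i < T.numLeaves) :
    (graftTree T i).numLeaves = T.numLeaves + 1 := by
  induction T generalizing i with
  | nil =>
    obtain rfl : i = 0 := by rw [numLeaves_nil] at h; omega
    rfl
  | node _ l r ihl ihr =>
    rw [numLeaves_node] at h ⊢
    rcases lt_or_ge i l.numLeaves with hi | hi
    · rw [graftTree_node_of_lt hi, numLeaves_node, ihl hi]; omega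
    · obtain ⟨i, rfl⟩ := Nat.exists_eq_add_of_le hi
      rw [graftTree_node_add, numLeaves_node, ihr (by omega)]; omega

theorem graftTree_ne_nil {T : BinaryTree Unit} {i : ℕ} (h : i < T.numLeaves) :
    graftTree T i ≠ .nil := by
  intro h'
  have h1 := numLeaves_graftTree h
  have h2 := T.numLeaves_pos
  rw [h', numLeaves_nil] at h1
  omega

/-- Grafting at `b` adds a leaf to the left of leaf `a`, whose index becomes `a + 1`. All later
commutation relations come from this shift. -/
theorem graftTree_graftTree (T : BinaryTree Unit) {a b : ℕ} (h : b < a) :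
    graftTree (graftTree T a) b = graftTree (graftTree T b) (a + 1) := by
  induction T generalizing a b with
  | nil =>
    obtain ⟨a, rfl⟩ := Nat.exists_eq_add_of_lt h
    rcases b with _ | b
    · simp [graftTree, BinaryTree.numLeaves]
    · rw [graftTree_of_le (T := .nil) (i := b + 1) (by rw [numLeaves_nil]; omega),
        graftTree_of_le (T := .nil) (i := b + 1 + a + 1) (by rw [numLeaves_nil]; omega),
        graftTree_of_le (by rw [numLeaves_nil]; omega),
        graftTree_of_le (by rw [numLeaves_nil]; omega)]
  | node _ l r ihl ihr =>
    rcases lt_or_ge a l.numLeaves with ha | ha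
    · have h1 := numLeaves_graftTree ha
      have h2 := numLeaves_graftTree (h.trans ha)
      rw [graftTree_node_of_lt ha, graftTree_node_of_lt (by omega),
        graftTree_node_of_lt (by omega), graftTree_node_of_lt (by omega), ihl h]
    · obtain ⟨a, rfl⟩ := Nat.exists_eq_add_of_le ha
      rw [graftTree_node_add]
      rcases lt_or_ge b l.numLeaves with hb | hb
      · have h2 := numLeaves_graftTree hb
        rw [graftTree_node_of_lt hb, graftTree_node_of_lt hb,
          show l.numLeaves + a + 1 = (graftTree l b).numLeaves + a by omega, graftTree_node_add]
      · obtain ⟨b, rfl⟩ := Nat.exists_eq_add_of_le hb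
        rw [graftTree_node_add, graftTree_node_add, add_assoc, graftTree_node_add,
          ihr (by omega)]

/-! ### Terminal nodes and trimming of trees -/

theorem mem_terminalLabels_node {l r : BinaryTree Unit} {k i : ℕ} :
    i ∈ terminalLabels (.node () l r) k ↔ (l = .nil ∧ r = .nil ∧ i = k) ∨
      i ∈ terminalLabels l k ∨ i ∈ terminalLabels r (k + l.numLeaves) := by
  simp [terminalLabels, or_assoc]

theorem bounds_of_mem_terminalLabels {T : BinaryTree Unit} {k i : ℕ}
    (h : i ∈ terminalLabels T k) : k ≤ i ∧ i + 1 < k + T.numLeaves := by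
  induction T generalizing k with
  | nil => simp [terminalLabels] at h
  | node _ l r ihl ihr =>
    have h1 := l.numLeaves_pos
    have h2 := r.numLeaves_pos
    rw [numLeaves_node]
    rcases mem_terminalLabels_node.1 h with ⟨_, _, rfl⟩ | h | h
    · omega
    · have := ihl h; omega
    · have := ihr h; omega

theorem trimTree_of_notMem {T : BinaryTree Unit} {k i : ℕ} (h : i ∉ terminalLabels T k) :
    trimTree i T k = T := by
  induction T generalizing k with
  | nil => rfl
  | node _ l r ihl ihr =>
    rw [mem_terminalLabels_node, not_or, not_or] at h
    rw [trimTree, if_neg h.1, ihl h.2.1, ihr h.2.2]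

theorem trimTree_node {l r : BinaryTree Unit} (h : l ≠ .nil ∨ r ≠ .nil) (i k : ℕ) :
    trimTree i (.node () l r) k = .node () (trimTree i l k) (trimTree i r (k + l.numLeaves)) := by
  rw [trimTree, if_neg (by tauto)]

theorem mem_terminalLabels_graftTree {T : BinaryTree Unit} {i : ℕ} (h : i < T.numLeaves) (k : ℕ) :
    k + i ∈ terminalLabels (graftTree T i) k := by
  induction T generalizing i k with
  | nil =>
    obtain rfl : i = 0 := by rw [numLeaves_nil] at h; omega
    exact mem_terminalLabels_node.2 (Or.inl ⟨rfl, rfl, rfl⟩)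
  | node _ l r ihl ihr =>
    rw [numLeaves_node] at h
    rcases lt_or_ge i l.numLeaves with hi | hi
    · rw [graftTree_node_of_lt hi, mem_terminalLabels_node]
      exact Or.inr (Or.inl (ihl hi k))
    · obtain ⟨i, rfl⟩ := Nat.exists_eq_add_of_le hi
      rw [graftTree_node_add, mem_terminalLabels_node, ← add_assoc]
      exact Or.inr (Or.inr (ihr (by omega) _))

theorem trimTree_graftTree {T : BinaryTree Unit} {i : ℕ} (h : i < T.numLeaves) (k : ℕ) :
    trimTree (k + i) (graftTree T i) k = T := by
  induction T generalizing i k with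
  | nil =>
    obtain rfl : i = 0 := by rw [numLeaves_nil] at h; omega
    simp [graftTree, trimTree]
  | node _ l r ihl ihr =>
    rw [numLeaves_node] at h
    rcases lt_or_ge i l.numLeaves with hi | hi
    · rw [graftTree_node_of_lt hi, trimTree_node (Or.inl (graftTree_ne_nil hi)), ihl hi,
        trimTree_of_notMem]
      intro hm
      have := bounds_of_mem_terminalLabels hm
      rw [numLeaves_graftTree hi] at this
      omega
    · obtain ⟨i, rfl⟩ := Nat.exists_eq_add_of_le hi
      have hi' : i < r.numLeaves := by omega
      rw [graftTree_node_add, trimTree_node (Or.inr (graftTree_ne_nil hi')), ← add_assoc, ihr hi',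
        trimTree_of_notMem]
      intro hm
      have := bounds_of_mem_terminalLabels hm
      omega

theorem numLeaves_trimTree {T : BinaryTree Unit} {k i : ℕ} (h : i ∈ terminalLabels T k) :
    (trimTree i T k).numLeaves + 1 = T.numLeaves := by
  induction T generalizing k with
  | nil => simp [terminalLabels] at h
  | node _ l r ihl ihr =>
    rcases mem_terminalLabels_node.1 h with ⟨rfl, rfl, rfl⟩ | h | h
    · simp [trimTree, BinaryTree.numLeaves]
    · have hl : l ≠ .nil := by rintro rfl; simp [terminalLabels] at h
      have hr : i ∉ terminalLabels r (k + l.numLeaves) := fun hr => by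
        have := bounds_of_mem_terminalLabels h
        have := bounds_of_mem_terminalLabels hr
        omega
      rw [trimTree_node (Or.inl hl), trimTree_of_notMem hr, numLeaves_node, numLeaves_node, ← ihl h]
      omega
    · have hr : r ≠ .nil := by rintro rfl; simp [terminalLabels] at h
      have hl : i ∉ terminalLabels l k := fun hl => by
        have := bounds_of_mem_terminalLabels h
        have := bounds_of_mem_terminalLabels hl
        omega
      rw [trimTree_node (Or.inr hr), trimTree_of_notMem hl, numLeaves_node, numLeaves_node, ← ihr h]
      omega

theorem graftTree_trimTree {T : BinaryTree Unit} {k i : ℕ} (h : i ∈ terminalLabels T k) :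
    graftTree (trimTree i T k) (i - k) = T := by
  induction T generalizing k with
  | nil => simp [terminalLabels] at h
  | node _ l r ihl ihr =>
    rcases mem_terminalLabels_node.1 h with ⟨rfl, rfl, rfl⟩ | h | h
    · simp [trimTree, graftTree]
    · have hl : l ≠ .nil := by rintro rfl; simp [terminalLabels] at h
      have hb := bounds_of_mem_terminalLabels h
      have hr : i ∉ terminalLabels r (k + l.numLeaves) := fun hr => by
        have := bounds_of_mem_terminalLabels hr
        omega
      have := numLeaves_trimTree h
      rw [trimTree_node (Or.inl hl), trimTree_of_notMem hr, graftTree_node_of_lt (by omega), ihl h]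
    · have hr : r ≠ .nil := by rintro rfl; simp [terminalLabels] at h
      have hb := bounds_of_mem_terminalLabels h
      have hl : i ∉ terminalLabels l k := fun hl => by
        have := bounds_of_mem_terminalLabels hl
        omega
      rw [trimTree_node (Or.inr hr), trimTree_of_notMem hl,
        show i - k = l.numLeaves + (i - (k + l.numLeaves)) by omega, graftTree_node_add, ihr h]

theorem exists_mem_terminalLabels {T : BinaryTree Unit} (h : T ≠ .nil) (k : ℕ) :
    ∃ i, i ∈ terminalLabels T k := by
  induction T generalizing k with
  | nil => exact absurd rfl h
  | node _ l r ihl ihr =>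
    by_cases hl : l = .nil
    · by_cases hr : r = .nil
      · exact ⟨k, mem_terminalLabels_node.2 (Or.inl ⟨hl, hr, rfl⟩)⟩
      · obtain ⟨i, hi⟩ := ihr hr (k + l.numLeaves)
        exact ⟨i, mem_terminalLabels_node.2 (Or.inr (Or.inr hi))⟩
    · obtain ⟨i, hi⟩ := ihl hl k
      exact ⟨i, mem_terminalLabels_node.2 (Or.inr (Or.inl hi))⟩

/-! ### Grafting and trimming of indexed forests -/

namespace IndexedForest

theorem ext_tree {F G : IndexedForest} (h : ∀ j, F.tree j = G.tree j) : F = G := by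
  cases F; cases G
  congr
  exact funext h

@[simp] theorem start_zero (F : IndexedForest) : F.start 0 = 0 := by simp [start]

theorem start_succ (F : IndexedForest) (j : ℕ) :
    F.start (j + 1) = F.start j + (F.tree j).numLeaves := Finset.sum_range_succ _ _

theorem start_strictMono (F : IndexedForest) : StrictMono F.start :=
  strictMono_nat_of_lt_succ fun j => by
    rw [start_succ]
    exact Nat.lt_add_of_pos_right (BinaryTree.numLeaves_pos _)

theorem le_start (F : IndexedForest) (j : ℕ) : j ≤ F.start j := F.start_strictMono.le_apply

/-- Every leaf belongs to a tree. -/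
theorem exists_start_le_lt (F : IndexedForest) (i : ℕ) :
    ∃ j, F.start j ≤ i ∧ i < F.start (j + 1) := by
  have h : ∃ j, i < F.start (j + 1) := ⟨i, F.le_start (i + 1)⟩
  refine ⟨Nat.find h, ?_, Nat.find_spec h⟩
  rcases hj : Nat.find h with _ | j
  · simp
  · exact not_lt.1 (Nat.find_min h (hj ▸ Nat.lt_succ_self j))

/-- Replace the leaf `i` of a forest by a terminal node. -/
def graft (F : IndexedForest) (i : ℕ) : IndexedForest where
  tree j := if F.start j ≤ i then graftTree (F.tree j) (i - F.start j) else F.tree j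
  finite_nontrivial := by
    refine (F.finite_nontrivial.union (Set.finite_Iic i)).subset fun j hj => ?_
    by_cases h : F.start j ≤ i
    · exact Or.inr ((F.le_start j).trans h)
    · simp only [h, if_false, Set.mem_ofPred_eq] at hj
      exact Or.inl hj

theorem graft_tree_of_le {F : IndexedForest} {i j : ℕ} (h : F.start (j + 1) ≤ i) :
    (F.graft i).tree j = F.tree j := by
  rw [start_succ] at h
  simp only [graft]
  rw [if_pos (by omega), graftTree_of_le (by omega)]

theorem graft_tree_of_lt {F : IndexedForest} {i j : ℕ} (h : i < F.start j) :
    (F.graft i).tree j = F.tree j := by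
  simp only [graft]
  rw [if_neg h.not_ge]

theorem graft_tree_of_le_lt {F : IndexedForest} {i j : ℕ} (h : F.start j ≤ i) :
    (F.graft i).tree j = graftTree (F.tree j) (i - F.start j) := by
  simp only [graft]
  rw [if_pos h]

theorem start_graft (F : IndexedForest) (i j : ℕ) :
    (F.graft i).start j = F.start j + if i < F.start j then 1 else 0 := by
  induction j with
  | zero => simp
  | succ j ih =>
    have hs := F.start_succ j
    rw [start_succ, ih]
    rcases lt_or_ge i (F.start j) with h | h
    · rw [graft_tree_of_lt h, if_pos h, if_pos (by omega)]; omega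
    · rw [if_neg (by omega)]
      rcases lt_or_ge i (F.start (j + 1)) with h' | h'
      · rw [graft_tree_of_le_lt h, if_pos h', numLeaves_graftTree (by omega)]; omega
      · rw [graft_tree_of_le h', if_neg (by omega)]; omega

theorem start_graft_of_lt {F : IndexedForest} {i j : ℕ} (h : i < F.start j) :
    (F.graft i).start j = F.start j + 1 := by rw [start_graft, if_pos h]

theorem start_graft_of_le {F : IndexedForest} {i j : ℕ} (h : F.start j ≤ i) :
    (F.graft i).start j = F.start j := by rw [start_graft, if_neg h.not_gt]; rfl

theorem graft_graft (F : IndexedForest) {a b : ℕ} (h : b < a) :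
    (F.graft a).graft b = (F.graft b).graft (a + 1) := by
  apply ext_tree
  intro j
  rcases lt_or_ge a (F.start j) with ha | ha
  · rw [graft_tree_of_lt (by rw [start_graft_of_lt ha]; omega), graft_tree_of_lt ha,
      graft_tree_of_lt (by rw [start_graft_of_lt (by omega)]; omega), graft_tree_of_lt (by omega)]
  · rcases lt_or_ge b (F.start j) with hb | hb
    · rw [graft_tree_of_lt (by rwa [start_graft_of_le ha]), graft_tree_of_le_lt ha,
        graft_tree_of_le_lt (by rw [start_graft_of_lt hb]; omega), graft_tree_of_lt hb,
        start_graft_of_lt hb, Nat.add_sub_add_right]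
    · rw [graft_tree_of_le_lt (by rwa [start_graft_of_le ha]), graft_tree_of_le_lt ha,
        graft_tree_of_le_lt (by rw [start_graft_of_le hb]; omega), graft_tree_of_le_lt hb,
        start_graft_of_le ha, start_graft_of_le hb, graftTree_graftTree _ (by omega),
        Nat.sub_add_comm ha]

theorem mem_qDes_graft (F : IndexedForest) (i : ℕ) : i ∈ (F.graft i).qDes := by
  obtain ⟨j, hj, hj'⟩ := F.exists_start_le_lt i
  refine ⟨j, ?_⟩
  rw [start_succ] at hj'
  rw [graft_tree_of_le_lt hj, start_graft_of_le hj]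
  have := mem_terminalLabels_graftTree (T := F.tree j) (i := i - F.start j) (by omega) (F.start j)
  rwa [Nat.add_sub_cancel' hj] at this

theorem trim_graft (F : IndexedForest) (i : ℕ) : (F.graft i).trim i = F := by
  apply ext_tree
  intro j
  change trimTree i ((F.graft i).tree j) ((F.graft i).start j) = F.tree j
  have hs := F.start_succ j
  rcases lt_or_ge i (F.start j) with h | h
  · rw [graft_tree_of_lt h, trimTree_of_notMem]
    intro hm
    have := bounds_of_mem_terminalLabels hm
    rw [start_graft_of_lt h] at this
    omega
  · rw [start_graft_of_le h]
    rcases lt_or_ge i (F.start (j + 1)) with h' | h'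
    · rw [graft_tree_of_le_lt h]
      have := trimTree_graftTree (T := F.tree j) (i := i - F.start j) (by omega) (F.start j)
      rwa [Nat.add_sub_cancel' h] at this
    · rw [graft_tree_of_le h', trimTree_of_notMem]
      intro hm
      have := bounds_of_mem_terminalLabels hm
      omega

theorem graft_trim {F : IndexedForest} {i : ℕ} (hi : i ∈ F.qDes) : (F.trim i).graft i = F := by
  obtain ⟨j₀, h₀⟩ := hi
  have hb := bounds_of_mem_terminalLabels h₀
  rw [← start_succ] at hb
  have hne : ∀ j, j ≠ j₀ → i ∉ terminalLabels (F.tree j) (F.start j) := by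
    intro j hj hm
    have hb' := bounds_of_mem_terminalLabels hm
    rw [← start_succ] at hb'
    rcases lt_or_gt_of_ne hj with h | h
    · have := F.start_strictMono.monotone (show j + 1 ≤ j₀ from h); omega
    · have := F.start_strictMono.monotone (show j₀ + 1 ≤ j from h); omega
  have htree : ∀ j, j ≠ j₀ → (F.trim i).tree j = F.tree j := fun j hj =>
    trimTree_of_notMem (hne j hj)
  -- Trimming removes one leaf, so exactly the trees to the right of `j₀` start one place earlier.
  have hstart : ∀ j, (j ≤ j₀ → (F.trim i).start j = F.start j) ∧
      (j₀ < j → (F.trim i).start j + 1 = F.start j) := by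
    intro j
    induction j with
    | zero => simp
    | succ j ih =>
      rw [start_succ, start_succ]
      rcases lt_trichotomy j j₀ with h | rfl | h
      · rw [htree j h.ne, ih.1 h.le]
        exact ⟨fun _ => rfl, fun h' => by omega⟩
      · rw [ih.1 le_rfl]
        refine ⟨fun h => by omega, fun _ => ?_⟩
        rw [← numLeaves_trimTree h₀]; rfl
      · rw [htree j h.ne', ← ih.2 h]
        exact ⟨fun h' => by omega, fun _ => by omega⟩
  apply ext_tree
  intro j
  rcases lt_trichotomy j j₀ with h | rfl | h
  · have := F.start_strictMono.monotone (show j + 1 ≤ j₀ from h)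
    rw [graft_tree_of_le, htree j h.ne]
    rw [(hstart (j + 1)).1 h]; omega
  · rw [graft_tree_of_le_lt (by rw [(hstart j).1 le_rfl]; exact hb.1), (hstart j).1 le_rfl]
    exact graftTree_trimTree h₀
  · have := F.start_strictMono.monotone (show j₀ + 1 ≤ j from h)
    have := (hstart j).2 h
    rw [graft_tree_of_lt (by omega), htree j h.ne']

theorem exists_mem_qDes {F : IndexedForest} (h : F ≠ empty) : ∃ i, i ∈ F.qDes := by
  by_contra hne
  refine h (ext_tree fun j => ?_)
  by_contra hj
  obtain ⟨i, hi⟩ := exists_mem_terminalLabels hj (F.start j)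
  exact hne ⟨i, j, hi⟩

theorem mem_qDes_iff {F : IndexedForest} {i : ℕ} :
    i ∈ F.qDes ↔ ∃ G : IndexedForest, F = G.graft i :=
  ⟨fun h => ⟨_, (graft_trim h).symm⟩, by rintro ⟨G, rfl⟩; exact mem_qDes_graft G i⟩

/-! ### The number of internal nodes -/

theorem exists_forall_tree_eq_nil (F : IndexedForest) : ∃ N, ∀ j, N ≤ j → F.tree j = .nil := by
  obtain ⟨N, hN⟩ := F.finite_nontrivial.bddAbove
  refine ⟨N + 1, fun j hj => ?_⟩
  by_contra h
  have := hN h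
  omega

/-- The number of internal nodes of a forest. -/
noncomputable def size (F : IndexedForest) : ℕ :=
  F.start F.exists_forall_tree_eq_nil.choose - F.exists_forall_tree_eq_nil.choose

theorem start_add_of_nil {F : IndexedForest} {N : ℕ} (h : ∀ j, N ≤ j → F.tree j = .nil) (d : ℕ) :
    F.start (N + d) = F.start N + d := by
  induction d with
  | zero => rfl
  | succ d ih => rw [← add_assoc, start_succ, ih, h _ (by omega), numLeaves_nil, add_assoc]

/-- Each tree has one leaf more than it has internal nodes; beyond the last nontrivial tree the
excess of leaves over trees is constant, so the `N` chosen in `size` is immaterial. -/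
theorem start_eq_add_size {F : IndexedForest} {N : ℕ} (h : ∀ j, N ≤ j → F.tree j = .nil) :
    F.start N = N + F.size := by
  have hM := F.exists_forall_tree_eq_nil.choose_spec
  have h1 := start_add_of_nil hM N
  have h2 := start_add_of_nil h F.exists_forall_tree_eq_nil.choose
  have h3 := F.le_start F.exists_forall_tree_eq_nil.choose
  rw [add_comm] at h2
  unfold size
  omega

theorem size_graft (F : IndexedForest) (i : ℕ) : (F.graft i).size = F.size + 1 := by
  obtain ⟨N, hN⟩ := F.exists_forall_tree_eq_nil
  obtain ⟨M, hM⟩ := (F.graft i).exists_forall_tree_eq_nil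
  have h1 := start_eq_add_size (N := N + M + i + 1) fun j hj => hN j (by omega)
  have h2 := start_eq_add_size (N := N + M + i + 1) fun j hj => hM j (by omega)
  have := F.le_start (N + M + i + 1)
  rw [start_graft_of_lt (by omega)] at h2
  omega

theorem size_trim {F : IndexedForest} {i : ℕ} (h : i ∈ F.qDes) : (F.trim i).size + 1 = F.size := by
  rw [← size_graft, graft_trim h]

theorem size_empty : size empty = 0 := by
  have := start_eq_add_size (F := empty) (N := 0) fun _ _ => rfl
  simpa using this.symm

theorem eq_empty_of_size {F : IndexedForest} (h : F.size = 0) : F = empty := by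
  by_contra hF
  obtain ⟨i, hi⟩ := exists_mem_qDes hF
  have := size_trim hi
  omega

theorem notMem_qDes_empty (i : ℕ) : i ∉ empty.qDes := fun h => by
  have := size_trim h
  rw [size_empty] at this
  omega

/-- Every forest is obtained from the empty one by grafting. -/
theorem graft_induction {motive : IndexedForest → Prop} (empty : motive empty)
    (graft : ∀ F i, motive F → motive (F.graft i)) (F : IndexedForest) : motive F := by
  induction h : F.size generalizing F with
  | zero => rw [eq_empty_of_size h]; exact empty
  | succ s ih =>
    obtain ⟨i, hi⟩ := exists_mem_qDes (F := F) (by rintro rfl; rw [size_empty] at h; omega)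
    rw [← graft_trim hi]
    exact graft _ _ (ih _ (by have := size_trim hi; omega))

theorem exists_qDes_lt (F : IndexedForest) : ∃ N, ∀ i ∈ F.qDes, i < N := by
  obtain ⟨N, hN⟩ := F.exists_forall_tree_eq_nil
  refine ⟨F.start N, ?_⟩
  rintro i ⟨j, hj⟩
  have hb := bounds_of_mem_terminalLabels hj
  rw [← start_succ] at hb
  rcases lt_or_ge j N with h | h
  · have := F.start_strictMono.monotone (show j + 1 ≤ N from h); omega
  · rw [hN j h] at hj
    simp [terminalLabels] at hj

/-! ### Commutation of trimmings -/

/-- Both sides say that `F` arises from a smaller forest by two grafts, in one order or the other.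
-/
theorem qDes_trim_comm {F : IndexedForest} {i m : ℕ} (h : i < m) :
    (m + 1 ∈ F.qDes ∧ i ∈ (F.trim (m + 1)).qDes) ↔ (i ∈ F.qDes ∧ m ∈ (F.trim i).qDes) := by
  constructor
  · rintro ⟨h1, h2⟩
    have key : F = (((F.trim (m + 1)).trim i).graft m).graft i := by
      rw [graft_graft _ h, graft_trim h2, graft_trim h1]
    rw [key, trim_graft]
    exact ⟨mem_qDes_graft _ _, mem_qDes_graft _ _⟩
  · rintro ⟨h1, h2⟩
    have key : F = (((F.trim i).trim m).graft i).graft (m + 1) := by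
      rw [← graft_graft _ h, graft_trim h2, graft_trim h1]
    rw [key, trim_graft]
    exact ⟨mem_qDes_graft _ _, mem_qDes_graft _ _⟩

theorem trim_trim_comm {F : IndexedForest} {i m : ℕ} (h : i < m) (h1 : i ∈ F.qDes)
    (h2 : m ∈ (F.trim i).qDes) : (F.trim (m + 1)).trim i = (F.trim i).trim m := by
  have key : F = (((F.trim i).trim m).graft i).graft (m + 1) := by
    rw [← graft_graft _ h, graft_trim h2, graft_trim h1]
  conv_lhs => rw [key, trim_graft, trim_graft]

end IndexedForest

/-! ### Forests supported on an initial segment -/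

theorem mem_forestsOn {n : ℕ} {F : IndexedForest} :
    F ∈ forestsOn n ↔ ∀ j, F.tree j ≠ .nil → F.start (j + 1) ≤ n := by
  constructor
  · intro h j hj
    have h1 := (F.tree j).numLeaves_pos
    have : F.start (j + 1) - 1 ∈ F.supp := by
      refine ⟨j, hj, ?_, ?_⟩ <;> rw [F.start_succ] <;> omega
    have := h this
    rw [F.start_succ] at *
    simp only [Set.mem_ofPred_eq] at this
    omega
  · rintro h k ⟨j, hj, h1, h2⟩
    rw [← F.start_succ] at h2
    exact h2.trans_le (h j hj)

theorem empty_mem_forestsOn (n : ℕ) : IndexedForest.empty ∈ forestsOn n :=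
  mem_forestsOn.2 fun _ h => absurd rfl h

theorem graft_mem_forestsOn {n i : ℕ} {F : IndexedForest} (hF : F ∈ forestsOn n) (hi : i < n) :
    F.graft i ∈ forestsOn (n + 1) := by
  rw [mem_forestsOn] at hF ⊢
  intro j hj
  by_cases h : F.tree j = .nil
  · have hs := F.start_succ j
    rw [h, numLeaves_nil] at hs
    rcases lt_or_ge i (F.start j) with h1 | h1
    · exact absurd ((F.graft_tree_of_lt h1).trans h) hj
    rcases lt_or_ge i (F.start (j + 1)) with h2 | h2
    · rw [F.start_graft_of_lt h2]; omega
    · exact absurd ((F.graft_tree_of_le h2).trans h) hj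
  · have := hF j h
    rw [F.start_graft]
    split_ifs <;> omega

theorem lt_of_graft_mem_forestsOn {n i : ℕ} {F : IndexedForest} (hF : F.graft i ∈ forestsOn n) :
    i + 1 < n := by
  obtain ⟨j, hj⟩ := F.mem_qDes_graft i
  have hb := bounds_of_mem_terminalLabels hj
  rw [← IndexedForest.start_succ] at hb
  refine hb.2.trans_le (mem_forestsOn.1 hF j fun h => ?_)
  rw [h] at hj
  simp [terminalLabels] at hj

theorem mem_forestsOn_of_graft {n i : ℕ} {F : IndexedForest} (hF : F.graft i ∈ forestsOn (n + 1)) :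
    F ∈ forestsOn n := by
  have hi := lt_of_graft_mem_forestsOn hF
  rw [mem_forestsOn] at hF ⊢
  intro j hj
  rcases lt_or_ge i (F.start (j + 1)) with h | h
  · have := hF j (by
      rcases lt_or_ge i (F.start j) with h1 | h1
      · rwa [F.graft_tree_of_lt h1]
      · rw [F.graft_tree_of_le_lt h1]
        rw [F.start_succ] at h
        exact graftTree_ne_nil (by omega))
    rw [F.start_graft_of_lt h] at this
    omega
  · omega

/-! ### Existence and uniqueness of the double forest polynomials -/

open Classical in
/-- The double forest polynomial of a forest with `s` internal nodes, by recursion on `s`. -/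
noncomputable def forestPolyAux : ℕ → IndexedForest → PolTX
  | 0, _ => 1
  | s + 1, F => Classical.epsilon fun f : PolTX => f.IsHomogeneous (s + 1) ∧ ev 1 f = 0 ∧
      ∀ i, equivariantTrim i f = if i ∈ F.qDes then omitT i (forestPolyAux s (F.trim i)) else 0

theorem equivariantTrim_forestPolyAux_zero {F : IndexedForest} (hF : F.size = 0) (i : ℕ) :
    equivariantTrim i (forestPolyAux 0 F) = 0 ∧ i ∉ F.qDes := by
  rw [IndexedForest.eq_empty_of_size hF]
  exact ⟨equivariantTrim_of_mem_firstVars (Nat.zero_le i) (one_mem _),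
    IndexedForest.notMem_qDes_empty i⟩

-- Induction on size: the trimmings prescribed for `F` satisfy the integrability relation, so the
-- choice is from a nonempty set. For `s = 0` the truncated `s - 1` is harmless, as nothing can be
-- trimmed.
open Classical in
theorem forestPolyAux_spec (s : ℕ) {F : IndexedForest} (hF : F.size = s) :
    (forestPolyAux s F).IsHomogeneous s ∧ ev 1 (forestPolyAux s F) = (if s = 0 then 1 else 0) ∧
      ∀ i, equivariantTrim i (forestPolyAux s F) =
        if i ∈ F.qDes then omitT i (forestPolyAux (s - 1) (F.trim i)) else 0 := by
  induction s generalizing F with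
  | zero =>
    refine ⟨isHomogeneous_one _ _, by simp [forestPolyAux], fun i => ?_⟩
    obtain ⟨h1, h2⟩ := equivariantTrim_forestPolyAux_zero hF i
    rw [h1, if_neg h2]
  | succ s ih =>
    suffices h : ∃ f : PolTX, f.IsHomogeneous (s + 1) ∧ ev 1 f = 0 ∧
      ∀ i, equivariantTrim i f = if i ∈ F.qDes then omitT i (forestPolyAux s (F.trim i)) else 0 by
      simpa [forestPolyAux] using Classical.epsilon_spec h
    have hsize : ∀ {i}, i ∈ F.qDes → (F.trim i).size = s := fun {i} hi => by
      have := IndexedForest.size_trim hi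
      omega
    obtain ⟨N, hN⟩ := F.exists_qDes_lt
    refine exists_equivariantTrim_eq (N := N) (fun i hi => if_neg fun h => ?_) (fun i => ?_) ?_
    · have := hN i h
      omega
    · split_ifs with hi
      · exact isHomogeneous_omitT i (ih (hsize hi)).1
      · exact isHomogeneous_zero _ _ _
    · intro i m him
      -- The two orders of trimming are possible simultaneously and lead to the same forest, and
      -- omitting the two parameters commutes in the same way.
      have hcomm := IndexedForest.qDes_trim_comm (F := F) him
      have hleft : (x m - t (m + 1)) * equivariantTrim i
            (if m + 1 ∈ F.qDes then omitT (m + 1) (forestPolyAux s (F.trim (m + 1))) else 0) =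
          (x m - t (m + 1)) * if m + 1 ∈ F.qDes ∧ i ∈ (F.trim (m + 1)).qDes then
            omitT (m + 1) (omitT i (forestPolyAux (s - 1) ((F.trim (m + 1)).trim i))) else 0 := by
        by_cases h1 : m + 1 ∈ F.qDes
        · rw [if_pos h1, equivariantTrim_omitT (by omega), (ih (hsize h1)).2.2 i]
          by_cases h2 : i ∈ (F.trim (m + 1)).qDes <;> simp [h1, h2]
        · rw [if_neg h1, if_neg (fun h => h1 h.1),
            equivariantTrim_of_mem_firstVars (Nat.zero_le i) (zero_mem _)]
      rw [hleft]
      by_cases h1 : i ∈ F.qDes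
      · rw [if_pos h1, insertT_sub_insertT_omitT him.le, (ih (hsize h1)).2.2 m]
        by_cases h2 : m ∈ (F.trim i).qDes
        · rw [if_pos h2, if_pos (hcomm.2 ⟨h1, h2⟩), omitT_omitT him.le,
            IndexedForest.trim_trim_comm him h1 h2]
        · rw [if_neg h2, if_neg (fun h => h2 (hcomm.1 h).2), map_zero]
      · rw [if_neg h1, if_neg (fun h => h1 (hcomm.1 h).1)]
        simp

theorem isDoubleForestFamily_forestPolyAux :
    IsDoubleForestFamily fun F => forestPolyAux F.size F where
  homogeneous F := ⟨_, (forestPolyAux_spec _ rfl).1⟩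
  normalized F := by
    rw [(forestPolyAux_spec _ rfl).2.1]
    by_cases h : F = IndexedForest.empty
    · rw [if_pos h, h, if_pos IndexedForest.size_empty]
    · rw [if_neg h, if_neg fun h' => h (IndexedForest.eq_empty_of_size h')]
  trimming F i := by
    rw [(forestPolyAux_spec _ rfl).2.2 i]
    by_cases h : i ∈ F.qDes
    · rw [if_pos h, if_pos h, ← IndexedForest.size_trim h, Nat.add_sub_cancel]
    · rw [if_neg h, if_neg h]

theorem IsDoubleForestFamily.unique {P Q : IndexedForest → PolTX} (hP : IsDoubleForestFamily P)
    (hQ : IsDoubleForestFamily Q) : P = Q := by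
  funext F
  induction hs : F.size using Nat.strong_induction_on generalizing F with
  | _ s ih =>
  rw [← sub_eq_zero]
  refine eq_zero_of_equivariantTrim (fun i => ?_) ?_
  · rw [equivariantTrim_sub, hP.trimming, hQ.trimming]
    by_cases hi : i ∈ F.qDes
    · have := IndexedForest.size_trim hi
      rw [if_pos hi, if_pos hi]
      rw [ih _ (by omega) (F.trim i) rfl, sub_self]
    · rw [if_neg hi, if_neg hi, sub_zero]
  · rw [map_sub, hP.normalized, hQ.normalized, sub_self]

theorem existsUnique_isDoubleForestFamily :
    ∃! P : IndexedForest → PolTX, IsDoubleForestFamily P :=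
  ⟨_, isDoubleForestFamily_forestPolyAux, fun _ hQ => hQ.unique isDoubleForestFamily_forestPolyAux⟩

theorem isDoubleForestFamily_doubleForestPoly : IsDoubleForestFamily doubleForestPoly :=
  Classical.epsilon_spec existsUnique_isDoubleForestFamily.exists

theorem ev_one_doubleForestPoly (F : IndexedForest) [Decidable (F = IndexedForest.empty)] :
    ev 1 (doubleForestPoly F) = if F = IndexedForest.empty then 1 else 0 := by
  rw [isDoubleForestFamily_doubleForestPoly.normalized]
  congr

theorem equivariantTrim_doubleForestPoly_graft (F : IndexedForest) (i : ℕ) :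
    equivariantTrim i (doubleForestPoly (F.graft i)) = omitT i (doubleForestPoly F) := by
  rw [isDoubleForestFamily_doubleForestPoly.trimming, if_pos (F.mem_qDes_graft i), F.trim_graft]

theorem equivariantTrim_doubleForestPoly_of_notMem {F : IndexedForest} {i : ℕ} (h : i ∉ F.qDes) :
    equivariantTrim i (doubleForestPoly F) = 0 := by
  rw [isDoubleForestFamily_doubleForestPoly.trimming, if_neg h]

/-! ### Inserting a fixed point into a permutation -/

theorem skip_strictMono (i : ℕ) : StrictMono (skip i) := fun a b h => by
  unfold skip; split_ifs <;> omega

theorem skip_ne (i k : ℕ) : skip i k ≠ i := by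
  unfold skip; split_ifs <;> omega

theorem skip_lt_iff {i k : ℕ} : skip i k < i ↔ k < i := by
  unfold skip; split_ifs <;> omega

theorem eq_or_eq_skip (i k : ℕ) : k = i ∨ ∃ m, k = skip i m := by
  rcases lt_trichotomy k i with h | h | h
  · exact Or.inr ⟨k, (skip_of_lt h).symm⟩
  · exact Or.inl h
  · exact Or.inr ⟨k - 1, by rw [skip_of_le (by omega)]; omega⟩

/-- The increasing bijection from `ℕ` to `ℕ \ {i}`. -/
def skipEquiv (i : ℕ) : ℕ ≃ {k : ℕ // k ≠ i} where
  toFun k := ⟨skip i k, skip_ne i k⟩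
  invFun k := if (k : ℕ) < i then k else k - 1
  left_inv k := by
    simp only [skip]
    split_ifs <;> omega
  right_inv := by
    rintro ⟨k, hk⟩
    simp only [skip, Subtype.mk.injEq]
    split_ifs <;> omega

/-- The permutation that fixes `i` and is given by `σ` on the complement of `i`. -/
def shiftPerm (i : ℕ) : Equiv.Perm ℕ →* Equiv.Perm ℕ :=
  Equiv.Perm.extendDomainHom (skipEquiv i)

@[simp] theorem shiftPerm_self (i : ℕ) (σ : Equiv.Perm ℕ) : shiftPerm i σ i = i :=
  Equiv.Perm.extendDomain_apply_not_subtype σ (skipEquiv i) (by simp)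

@[simp] theorem shiftPerm_skip (i : ℕ) (σ : Equiv.Perm ℕ) (k : ℕ) :
    shiftPerm i σ (skip i k) = skip i (σ k) :=
  Equiv.Perm.extendDomain_apply_image σ (skipEquiv i) k

theorem shiftPerm_of_lt {i k : ℕ} (σ : Equiv.Perm ℕ) (h : k < i) :
    shiftPerm i σ k = skip i (σ k) := by
  conv_lhs => rw [← skip_of_lt h, shiftPerm_skip]

theorem shiftPerm_succ_of_le {i k : ℕ} (σ : Equiv.Perm ℕ) (h : i ≤ k) :
    shiftPerm i σ (k + 1) = skip i (σ k) := by
  rw [← skip_of_le h, shiftPerm_skip]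

theorem shiftPerm_injective (i : ℕ) : Function.Injective (shiftPerm i) :=
  Equiv.Perm.extendDomainHom_injective (skipEquiv i)

theorem eq_shiftPerm {i : ℕ} {σ τ : Equiv.Perm ℕ} (h : τ i = i)
    (h' : ∀ k, τ (skip i k) = skip i (σ k)) : τ = shiftPerm i σ := by
  ext k
  rcases eq_or_eq_skip i k with rfl | ⟨m, rfl⟩
  · rw [h, shiftPerm_self]
  · rw [h', shiftPerm_skip]

theorem exists_eq_shiftPerm {i : ℕ} {τ : Equiv.Perm ℕ} (h : τ i = i) : ∃ σ, τ = shiftPerm i σ := by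
  refine ⟨(skipEquiv i).permCongr.symm (τ.subtypePerm (p := fun k => k ≠ i) fun k => ?_),
    eq_shiftPerm h fun k => ?_⟩
  · conv_lhs => rw [← h]
    rw [τ.injective.ne_iff]
  · have : ∀ m, skip i m = (skipEquiv i m : ℕ) := fun _ => rfl
    simp [this]

theorem shiftPerm_swap (i a b : ℕ) :
    shiftPerm i (Equiv.swap a b) = Equiv.swap (skip i a) (skip i b) := by
  symm
  apply eq_shiftPerm
  · exact Equiv.swap_apply_of_ne_of_ne (skip_ne i a).symm (skip_ne i b).symm
  · intro k
    exact ((skip_strictMono i).injective.map_swap a b k).symm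

@[simp] theorem simpleTransposition_self (i : ℕ) : simpleTransposition i i = i + 1 :=
  Equiv.swap_apply_left _ _

@[simp] theorem simpleTransposition_succ (i : ℕ) : simpleTransposition i (i + 1) = i :=
  Equiv.swap_apply_right _ _

theorem simpleTransposition_of_ne {i k : ℕ} (h : k ≠ i) (h' : k ≠ i + 1) :
    simpleTransposition i k = k := Equiv.swap_apply_of_ne_of_ne h h'

@[simp] theorem simpleTransposition_mul_self (i : ℕ) :
    simpleTransposition i * simpleTransposition i = 1 := Equiv.swap_mul_self _ _

/-- Insert the letter `i` next to position `i` of the one-line form of `σ`, such that there is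
a descent at `i`. -/
def insertDesc (i : ℕ) (σ : Equiv.Perm ℕ) : Equiv.Perm ℕ :=
  if σ i < i then shiftPerm i σ else shiftPerm i σ * simpleTransposition i

/-- Insert the letter `i` next to position `i` of the one-line form of `σ`, such that there is
an ascent at `i`. -/
def insertAsc (i : ℕ) (σ : Equiv.Perm ℕ) : Equiv.Perm ℕ :=
  if σ i < i then shiftPerm i σ * simpleTransposition i else shiftPerm i σ

theorem insertAsc_mul (i : ℕ) (σ : Equiv.Perm ℕ) :
    insertAsc i σ * simpleTransposition i = insertDesc i σ := by
  unfold insertAsc insertDesc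
  split_ifs <;> simp [mul_assoc]

theorem shiftPerm_mul_simpleTransposition_self (i : ℕ) (σ : Equiv.Perm ℕ) :
    (shiftPerm i σ * simpleTransposition i) i = skip i (σ i) := by
  simp [shiftPerm_succ_of_le]

theorem shiftPerm_mul_simpleTransposition_succ (i : ℕ) (σ : Equiv.Perm ℕ) :
    (shiftPerm i σ * simpleTransposition i) (i + 1) = i := by
  simp

theorem insertAsc_lt (i : ℕ) (σ : Equiv.Perm ℕ) : insertAsc i σ i < insertAsc i σ (i + 1) := by
  unfold insertAsc
  split_ifs with h
  · rw [shiftPerm_mul_simpleTransposition_self, shiftPerm_mul_simpleTransposition_succ]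
    exact skip_lt_iff.2 h
  · rw [shiftPerm_self, shiftPerm_succ_of_le _ le_rfl, skip_of_le (not_lt.1 h)]
    omega

theorem insertDesc_self_ge (i : ℕ) (σ : Equiv.Perm ℕ) : i ≤ insertDesc i σ i := by
  unfold insertDesc
  split_ifs with h
  · rw [shiftPerm_self]
  · rw [shiftPerm_mul_simpleTransposition_self, skip_of_le (not_lt.1 h)]
    omega

theorem insertDesc_succ_le (i : ℕ) (σ : Equiv.Perm ℕ) : insertDesc i σ (i + 1) ≤ i := by
  unfold insertDesc
  split_ifs with h
  · rw [shiftPerm_succ_of_le _ le_rfl]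
    exact (skip_lt_iff.2 h).le
  · rw [shiftPerm_mul_simpleTransposition_succ]

theorem insertDesc_skip {i k : ℕ} (σ : Equiv.Perm ℕ) (h : k ≠ i) :
    insertDesc i σ (skip i k) = skip i (σ k) := by
  have h1 : skip i k ≠ i + 1 := by
    intro h2
    refine h ((skip_strictMono i).injective ?_)
    rw [h2, skip_of_le le_rfl]
  unfold insertDesc
  split_ifs
  · exact shiftPerm_skip _ _ _
  · rw [Equiv.Perm.mul_apply, simpleTransposition_of_ne (skip_ne i k) h1, shiftPerm_skip]

theorem insertDesc_injective (i : ℕ) : Function.Injective (insertDesc i) := by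
  intro σ τ h
  -- The result fixes `i` exactly when the letter was inserted at position `i`, so it reveals which
  -- branch of the definition was taken.
  have key : ∀ ρ, (insertDesc i ρ i = i ↔ ρ i < i) := by
    intro ρ
    unfold insertDesc
    split_ifs with h
    · simpa using h
    · rw [shiftPerm_mul_simpleTransposition_self]
      simp [skip_ne, h]
  have hiff : σ i < i ↔ τ i < i := by rw [← key σ, h, key τ]
  unfold insertDesc at h
  by_cases hσ : σ i < i
  · rw [if_pos hσ, if_pos (hiff.1 hσ)] at h
    exact shiftPerm_injective i h
  · rw [if_neg hσ, if_neg (fun h' => hσ (hiff.2 h'))] at h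
    exact shiftPerm_injective i (mul_right_cancel h)

/-! ### Rank functions -/

/-- The number of `k < a` with `b ≤ σ k`. -/
def rank (σ : Equiv.Perm ℕ) (a b : ℕ) : ℕ := ((Finset.range a).filter fun k => b ≤ σ k).card

@[simp] theorem rank_zero (σ : Equiv.Perm ℕ) (b : ℕ) : rank σ 0 b = 0 := by simp [rank]

theorem rank_succ (σ : Equiv.Perm ℕ) (a b : ℕ) :
    rank σ (a + 1) b = rank σ a b + if b ≤ σ a then 1 else 0 := by
  unfold rank
  rw [Finset.range_add_one, Finset.filter_insert]
  split_ifs <;> simp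

theorem rank_succ_right (σ : Equiv.Perm ℕ) (a b : ℕ) :
    rank σ a b = rank σ a (b + 1) + if σ.symm b < a then 1 else 0 := by
  induction a with
  | zero => simp
  | succ a ih =>
    rw [rank_succ, rank_succ, ih]
    have : σ.symm b = a ↔ σ a = b := by rw [Equiv.symm_apply_eq, eq_comm]
    have h1 : σ.symm b < a + 1 ↔ σ.symm b < a ∨ σ a = b := by rw [← this]; omega
    have h2 : ¬ (σ.symm b < a ∧ σ a = b) := by rw [← this]; omega
    split_ifs <;> omega

/-- The new fixed point cuts the permutation matrix into four quadrants, treated here and in the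
next three lemmas; it is counted only when it lies before the row bound and at or above the value
bound. -/
theorem rank_shiftPerm_le_le {i a b : ℕ} (σ : Equiv.Perm ℕ) (ha : a ≤ i) (hb : b ≤ i) :
    rank (shiftPerm i σ) a b = rank σ a b := by
  induction a with
  | zero => simp
  | succ a ih =>
    rw [rank_succ, rank_succ, ih (by omega), shiftPerm_of_lt _ (by omega)]
    congr 2
    simp only [skip, eq_iff_iff]
    split_ifs <;> omega

theorem rank_shiftPerm_le_succ {i a b : ℕ} (σ : Equiv.Perm ℕ) (ha : a ≤ i) (hb : i ≤ b) :
    rank (shiftPerm i σ) a (b + 1) = rank σ a b := by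
  induction a with
  | zero => simp
  | succ a ih =>
    rw [rank_succ, rank_succ, ih (by omega), shiftPerm_of_lt _ (by omega)]
    congr 2
    simp only [skip, eq_iff_iff]
    split_ifs <;> omega

theorem rank_shiftPerm_succ_le {i a b : ℕ} (σ : Equiv.Perm ℕ) (ha : i ≤ a) (hb : b ≤ i) :
    rank (shiftPerm i σ) (a + 1) b = rank σ a b + 1 := by
  induction a, ha using Nat.le_induction with
  | base => rw [rank_succ, rank_shiftPerm_le_le σ le_rfl hb, shiftPerm_self, if_pos hb]
  | succ a ha ih =>
    rw [rank_succ, ih, rank_succ, shiftPerm_succ_of_le _ ha, add_right_comm]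
    congr 3
    simp only [skip, eq_iff_iff]
    split_ifs <;> omega

theorem rank_shiftPerm_succ_succ {i a b : ℕ} (σ : Equiv.Perm ℕ) (ha : i ≤ a) (hb : i ≤ b) :
    rank (shiftPerm i σ) (a + 1) (b + 1) = rank σ a b := by
  induction a, ha using Nat.le_induction with
  | base =>
    rw [rank_succ, rank_shiftPerm_le_succ σ le_rfl hb, shiftPerm_self, if_neg (by omega)]
    rfl
  | succ a ha ih =>
    rw [rank_succ, ih, rank_succ, shiftPerm_succ_of_le _ ha]
    congr 2
    simp only [skip, eq_iff_iff]
    split_ifs <;> omega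

theorem rank_mul_simpleTransposition_of_le {i a : ℕ} (τ : Equiv.Perm ℕ) (ha : a ≤ i) (b : ℕ) :
    rank (τ * simpleTransposition i) a b = rank τ a b := by
  induction a with
  | zero => simp
  | succ a ih =>
    rw [rank_succ, rank_succ, ih (by omega), Equiv.Perm.mul_apply,
      simpleTransposition_of_ne (by omega) (by omega)]

theorem rank_mul_simpleTransposition_succ (i : ℕ) (τ : Equiv.Perm ℕ) (b : ℕ) :
    rank (τ * simpleTransposition i) (i + 1) b =
      rank τ i b + if b ≤ τ (i + 1) then 1 else 0 := by
  rw [rank_succ, rank_mul_simpleTransposition_of_le _ le_rfl, Equiv.Perm.mul_apply,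
    simpleTransposition_self]

theorem rank_mul_simpleTransposition_of_ge {i a : ℕ} (τ : Equiv.Perm ℕ) (ha : i + 2 ≤ a) (b : ℕ) :
    rank (τ * simpleTransposition i) a b = rank τ a b := by
  induction a, ha using Nat.le_induction with
  | base =>
    rw [rank_succ, rank_mul_simpleTransposition_succ, Equiv.Perm.mul_apply,
      simpleTransposition_succ, rank_succ, rank_succ]
    omega
  | succ a ha ih =>
    rw [rank_succ, rank_succ, ih, Equiv.Perm.mul_apply,
      simpleTransposition_of_ne (by omega) (by omega)]

theorem rank_mul_simpleTransposition_of_ne {i a : ℕ} (τ : Equiv.Perm ℕ) (ha : a ≠ i + 1) (b : ℕ) :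
    rank (τ * simpleTransposition i) a b = rank τ a b := by
  rcases lt_or_gt_of_ne ha with h | h
  · exact rank_mul_simpleTransposition_of_le τ (by omega) b
  · exact rank_mul_simpleTransposition_of_ge τ h b

/-! ### The two ranks next to the diagonal -/

/-- The transposition at `i` permutes two positions within the first `a`, or two beyond them, unless
`a = i + 1`. -/
theorem rank_insert_of_ne {i a : ℕ} (σ : Equiv.Perm ℕ) (ha : a ≠ i + 1) (b : ℕ) :
    rank (insertDesc i σ) a b = rank (shiftPerm i σ) a b ∧
      rank (insertAsc i σ) a b = rank (shiftPerm i σ) a b := by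
  unfold insertDesc insertAsc
  split_ifs
  · exact ⟨rfl, rank_mul_simpleTransposition_of_ne _ ha b⟩
  · exact ⟨rank_mul_simpleTransposition_of_ne _ ha b, rfl⟩

theorem rank_insertDesc_diag (i : ℕ) (σ : Equiv.Perm ℕ) :
    rank (insertDesc i σ) (i + 1) i = rank σ i i + 1 ∧
      rank (insertDesc i σ) (i + 1) (i + 1) = rank σ (i + 1) i := by
  unfold insertDesc
  rw [rank_succ σ i i]
  split_ifs with h1 h2 h2
  · omega
  · rw [rank_shiftPerm_succ_le _ le_rfl le_rfl, rank_shiftPerm_succ_succ _ le_rfl le_rfl]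
    exact ⟨rfl, rfl⟩
  · rw [rank_mul_simpleTransposition_succ, rank_mul_simpleTransposition_succ,
      shiftPerm_succ_of_le _ le_rfl, skip_of_le h2, rank_shiftPerm_le_le _ le_rfl le_rfl,
      rank_shiftPerm_le_succ _ le_rfl le_rfl, if_pos (by omega), if_pos (by omega)]
    exact ⟨rfl, rfl⟩
  · omega

theorem rank_insertAsc_diag (i : ℕ) (σ : Equiv.Perm ℕ) :
    rank (insertAsc i σ) (i + 1) i = rank σ (i + 1) i ∧
      rank (insertAsc i σ) (i + 1) (i + 1) = rank σ i i := by
  unfold insertAsc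
  rw [rank_succ σ i i]
  split_ifs with h1 h2 h2
  · omega
  · rw [rank_mul_simpleTransposition_succ, rank_mul_simpleTransposition_succ,
      shiftPerm_succ_of_le _ le_rfl, skip_of_lt h1, rank_shiftPerm_le_le _ le_rfl le_rfl,
      rank_shiftPerm_le_succ _ le_rfl le_rfl, if_neg (by omega), if_neg (by omega)]
    exact ⟨rfl, rfl⟩
  · rw [rank_shiftPerm_succ_le _ le_rfl le_rfl, rank_shiftPerm_succ_succ _ le_rfl le_rfl]
    exact ⟨rfl, rfl⟩
  · omega

/-- Comparison of the ranks on and next to the diagonal. -/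
def RankLE (π σ : Equiv.Perm ℕ) : Prop :=
  ∀ b, rank π b b ≤ rank σ b b ∧ rank π (b + 1) b ≤ rank σ (b + 1) b

/-- Isolates the entries `(i + 1, i + 1)` and `(i + 1, i)`, when `p b` concerns `(b, b)` and `q b`
concerns `(b + 1, b)`. The other entries match those of the permutation before insertion. -/
theorem forall_diag_iff {i : ℕ} (p q : ℕ → Prop) :
    (∀ b, p b ∧ q b) ↔ (p (i + 1) ∧ q i) ∧ (∀ b ≤ i, p b) ∧ (∀ b < i, q b) ∧
      (∀ b, i < b → p (b + 1)) ∧ (∀ b, i ≤ b → q (b + 1)) := by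
  refine ⟨fun h => ⟨⟨(h _).1, (h _).2⟩, fun b _ => (h b).1, fun b _ => (h b).2,
    fun b _ => (h _).1, fun b _ => (h _).2⟩, fun ⟨⟨h1, h2⟩, h3, h4, h5, h6⟩ b => ⟨?_, ?_⟩⟩
  · rcases lt_trichotomy b (i + 1) with h | rfl | h
    · exact h3 b (by omega)
    · exact h1
    · obtain ⟨c, rfl⟩ : ∃ c, b = c + 1 := ⟨b - 1, by omega⟩
      exact h5 c (by omega)
  · rcases lt_trichotomy b i with h | rfl | h
    · exact h4 b h
    · exact h2
    · obtain ⟨c, rfl⟩ : ∃ c, b = c + 1 := ⟨b - 1, by omega⟩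
      exact h6 c (by omega)

/-- The ranks near the diagonal are the same for both insertions, but for two of them. -/
theorem rank_insert_away (i : ℕ) (σ : Equiv.Perm ℕ) :
    (∀ b ≤ i, rank (insertDesc i σ) b b = rank σ b b ∧ rank (insertAsc i σ) b b = rank σ b b) ∧
    (∀ b < i, rank (insertDesc i σ) (b + 1) b = rank σ (b + 1) b ∧
      rank (insertAsc i σ) (b + 1) b = rank σ (b + 1) b) ∧
    (∀ b, i < b → rank (insertDesc i σ) (b + 1) (b + 1) = rank σ b b ∧
      rank (insertAsc i σ) (b + 1) (b + 1) = rank σ b b) ∧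
    (∀ b, i ≤ b → rank (insertDesc i σ) (b + 1 + 1) (b + 1) = rank σ (b + 1) b ∧
      rank (insertAsc i σ) (b + 1 + 1) (b + 1) = rank σ (b + 1) b) := by
  refine ⟨fun b hb => ?_, fun b hb => ?_, fun b hb => ?_, fun b hb => ?_⟩
  · have := rank_insert_of_ne (i := i) (a := b) σ (by omega) b
    rwa [rank_shiftPerm_le_le σ hb hb] at this
  · have := rank_insert_of_ne (i := i) (a := b + 1) σ (by omega) b
    rwa [rank_shiftPerm_le_le σ hb hb.le] at this
  · have := rank_insert_of_ne (i := i) (a := b + 1) σ (by omega) (b + 1)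
    rwa [rank_shiftPerm_succ_succ σ hb.le hb.le] at this
  · have := rank_insert_of_ne (i := i) (a := b + 1 + 1) σ (by omega) (b + 1)
    rwa [rank_shiftPerm_succ_succ σ (by omega) hb] at this

theorem rankLE_insertAsc_insertDesc (i : ℕ) (σ : Equiv.Perm ℕ) :
    RankLE (insertAsc i σ) (insertDesc i σ) := by
  obtain ⟨h1, h2, h3, h4⟩ := rank_insert_away i σ
  obtain ⟨h5, h6⟩ := rank_insertAsc_diag i σ
  obtain ⟨h7, h8⟩ := rank_insertDesc_diag i σ
  have h9 := rank_succ σ i i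
  refine (forall_diag_iff (i := i) _ _).2 ⟨⟨?_, ?_⟩, fun b hb => ?_, fun b hb => ?_, fun b hb => ?_,
    fun b hb => ?_⟩
  · rw [h6, h8]; omega
  · rw [h5, h7]; split_ifs at h9 <;> omega
  · rw [(h1 b hb).1, (h1 b hb).2]
  · rw [(h2 b hb).1, (h2 b hb).2]
  · rw [(h3 b hb).1, (h3 b hb).2]
  · rw [(h4 b hb).1, (h4 b hb).2]

theorem RankLE.insertAsc {π σ : Equiv.Perm ℕ} (h : RankLE π σ) (i : ℕ) :
    RankLE (insertAsc i π) (insertAsc i σ) := by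
  obtain ⟨h1, h2, h3, h4⟩ := rank_insert_away i σ
  obtain ⟨h5, h6⟩ := rank_insertAsc_diag i σ
  obtain ⟨k1, k2, k3, k4⟩ := rank_insert_away i π
  obtain ⟨k5, k6⟩ := rank_insertAsc_diag i π
  refine (forall_diag_iff (i := i) _ _).2 ⟨⟨?_, ?_⟩, fun b hb => ?_, fun b hb => ?_, fun b hb => ?_,
    fun b hb => ?_⟩
  · rw [h6, k6]; exact (h i).1
  · rw [h5, k5]; exact (h i).2
  · rw [(h1 b hb).2, (k1 b hb).2]; exact (h b).1
  · rw [(h2 b hb).2, (k2 b hb).2]; exact (h b).2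
  · rw [(h3 b hb).2, (k3 b hb).2]; exact (h b).1
  · rw [(h4 b hb).2, (k4 b hb).2]; exact (h b).2

/-- Each rank of `σ` near the diagonal occurs among those of `insertDesc i σ`, and the two
exceptional entries of the latter are again such ranks, up to adding one. -/
theorem rankLE_insertDesc_iff {π σ : Equiv.Perm ℕ} {i : ℕ} :
    RankLE (insertDesc i π) (insertDesc i σ) ↔ RankLE π σ := by
  obtain ⟨h1, h2, h3, h4⟩ := rank_insert_away i σ
  obtain ⟨h5, h6⟩ := rank_insertDesc_diag i σ
  obtain ⟨k1, k2, k3, k4⟩ := rank_insert_away i π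
  obtain ⟨k5, k6⟩ := rank_insertDesc_diag i π
  constructor
  · intro h b
    constructor
    · rcases le_or_gt b i with hb | hb
      · rw [← (h1 b hb).1, ← (k1 b hb).1]; exact (h b).1
      · rw [← (h3 b hb).1, ← (k3 b hb).1]; exact (h _).1
    · rcases lt_or_ge b i with hb | hb
      · rw [← (h2 b hb).1, ← (k2 b hb).1]; exact (h b).2
      · rw [← (h4 b hb).1, ← (k4 b hb).1]; exact (h _).2
  · intro h
    refine (forall_diag_iff (i := i) _ _).2 ⟨⟨?_, ?_⟩, fun b hb => ?_, fun b hb => ?_,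
      fun b hb => ?_, fun b hb => ?_⟩
    · rw [h6, k6]; exact (h i).2
    · rw [h5, k5]; exact Nat.succ_le_succ (h i).1
    · rw [(h1 b hb).1, (k1 b hb).1]; exact (h b).1
    · rw [(h2 b hb).1, (k2 b hb).1]; exact (h b).2
    · rw [(h3 b hb).1, (k3 b hb).1]; exact (h b).1
    · rw [(h4 b hb).1, (k4 b hb).1]; exact (h b).2

theorem RankLE.trans {π σ τ : Equiv.Perm ℕ} (h : RankLE π σ) (h' : RankLE σ τ) : RankLE π τ :=
  fun b => ⟨(h b).1.trans (h' b).1, (h b).2.trans (h' b).2⟩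

/-- Only row `i + 1` can fail. If `π i < i`, both its entries are at most `rank π i i`; if `i < π (i
+ 1)`, they are controlled by the entry `(i + 2, i + 1)` of `π`. Either way they satisfy the sharper
bounds of the ascent. -/
theorem RankLE.insertAsc_or {π σ : Equiv.Perm ℕ} {i : ℕ} (h : RankLE π (insertDesc i σ)) :
    RankLE π (DoubleForest.insertAsc i σ) ∨ (i ≤ π i ∧ π (i + 1) ≤ i) := by
  by_cases hqd : i ≤ π i ∧ π (i + 1) ≤ i
  · exact Or.inr hqd
  left
  obtain ⟨h1, h2, h3, h4⟩ := rank_insert_away i σ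
  obtain ⟨h5, h6⟩ := rank_insertAsc_diag i σ
  obtain ⟨h7, h8⟩ := rank_insertDesc_diag i σ
  have hi := h i
  have hi' := h (i + 1)
  rw [h7, (h1 i le_rfl).1] at hi
  rw [h8, (h4 i le_rfl).1] at hi'
  have e1 := rank_succ σ i i
  have e2 := rank_succ π i i
  have e3 := rank_succ π (i + 1) (i + 1)
  have e4 := rank_succ_right π (i + 1) i
  refine (forall_diag_iff (i := i) _ _).2 ⟨?_, fun b hb => ?_, fun b hb => ?_, fun b hb => ?_,
    fun b hb => ?_⟩
  · rw [h5, h6]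
    constructor <;> split_ifs at e1 e2 e3 e4 <;> omega
  · rw [(h1 b hb).2, ← (h1 b hb).1]; exact (h b).1
  · rw [(h2 b hb).2, ← (h2 b hb).1]; exact (h b).2
  · rw [(h3 b hb).2, ← (h3 b hb).1]; exact (h _).1
  · rw [(h4 b hb).2, ← (h4 b hb).1]; exact (h _).2

theorem eq_one_of_forall_le {π : Equiv.Perm ℕ} (h : ∀ k, π k ≤ k) : π = 1 := by
  ext k
  rw [Equiv.Perm.one_apply]
  induction k using Nat.strong_induction_on with
  | _ k ih =>
    rcases (h k).eq_or_lt with h | h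
    · exact h
    · exact absurd (π.injective (ih _ h)) h.ne

/-- The vanishing of the ranks `(k + 1, k + 1)` gives `π k ≤ k` for all `k`. -/
theorem RankLE.eq_one {π : Equiv.Perm ℕ} (h : RankLE π 1) : π = 1 := by
  refine eq_one_of_forall_le fun k => ?_
  have h0 : rank 1 (k + 1) (k + 1) = 0 := by
    unfold rank
    rw [Finset.card_eq_zero, Finset.filter_eq_empty_iff]
    intro m hm
    rw [Finset.mem_range] at hm
    simpa using hm
  have h1 := (h (k + 1)).1
  rw [h0, Nat.le_zero, rank_succ] at h1
  split_ifs at h1 with h2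
  omega

/-! ### Inversions and reduced words -/

/-- The inversions of a permutation. -/
def inversions (τ : Equiv.Perm ℕ) : Set (ℕ × ℕ) := {p | p.1 < p.2 ∧ τ p.2 < τ p.1}

theorem simpleTransposition_lt {i a b : ℕ} (h : a < b) (h' : ¬ (a = i ∧ b = i + 1)) :
    simpleTransposition i a < simpleTransposition i b := by
  simp only [simpleTransposition, Equiv.swap_apply_def]
  split_ifs <;> omega

theorem simpleTransposition_simpleTransposition (i a : ℕ) :
    simpleTransposition i (simpleTransposition i a) = a := Equiv.swap_apply_self _ _ _

/-- Exchanging `i` and `i + 1` in both coordinates carries the old inversions to the new ones other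
than `(i, i + 1)`. -/
theorem encard_inversions_mul {i : ℕ} {τ : Equiv.Perm ℕ} (h : τ i < τ (i + 1)) :
    (inversions (τ * simpleTransposition i)).encard = (inversions τ).encard + 1 := by
  have hinj : Function.Injective
      (Prod.map (simpleTransposition i) (simpleTransposition i)) :=
    (simpleTransposition i).injective.prodMap (simpleTransposition i).injective
  have key : inversions (τ * simpleTransposition i) = insert (i, i + 1)
      (Prod.map (simpleTransposition i) (simpleTransposition i) '' inversions τ) := by
    ext ⟨a, b⟩
    constructor
    · rintro ⟨hab, hτ⟩
      by_cases hne : a = i ∧ b = i + 1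
      · exact Or.inl (by rw [hne.1, hne.2])
      · refine Or.inr ⟨(simpleTransposition i a, simpleTransposition i b),
          ⟨simpleTransposition_lt hab hne, hτ⟩, ?_⟩
        simp [simpleTransposition_simpleTransposition]
    · rintro (heq | ⟨⟨c, d⟩, ⟨hcd, hτ⟩, heq⟩)
      · obtain ⟨rfl, rfl⟩ := Prod.mk.inj heq
        exact ⟨Nat.lt_succ_self _, by simpa using h⟩
      · obtain ⟨rfl, rfl⟩ := Prod.mk.inj heq
        refine ⟨simpleTransposition_lt hcd ?_, ?_⟩
        · rintro ⟨rfl, rfl⟩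
          exact absurd h hτ.not_gt
        · simpa [simpleTransposition_simpleTransposition] using hτ
  rw [key, Set.encard_insert_of_notMem, hinj.encard_image]
  rintro ⟨⟨c, d⟩, ⟨hcd, hτ⟩, heq⟩
  obtain ⟨h1, h2⟩ := Prod.mk.inj heq
  have h3 := congrArg (simpleTransposition i) h1
  have h4 := congrArg (simpleTransposition i) h2
  rw [simpleTransposition_simpleTransposition, simpleTransposition_self] at h3
  rw [simpleTransposition_simpleTransposition, simpleTransposition_succ] at h4
  simp only at h3 h4 hcd
  omega

theorem encard_inversions_of_gt {i : ℕ} {τ : Equiv.Perm ℕ} (h : τ (i + 1) < τ i) :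
    (inversions τ).encard = (inversions (τ * simpleTransposition i)).encard + 1 := by
  rw [← encard_inversions_mul (i := i) (τ := τ * simpleTransposition i) (by simpa using h),
    mul_assoc, simpleTransposition_mul_self, mul_one]

theorem wordProd_concat (w : List ℕ) (i : ℕ) :
    wordProd (w ++ [i]) = wordProd w * simpleTransposition i := by
  simp [wordProd]

theorem encard_inversions_wordProd_le (w : List ℕ) :
    (inversions (wordProd w)).encard ≤ w.length := by
  induction w using List.reverseRecOn with
  | nil =>
    have : inversions (wordProd []) = ∅ := by
      ext ⟨a, b⟩
      simp only [inversions, wordProd, List.map_nil, List.prod_nil, Equiv.Perm.one_apply,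
        Set.mem_ofPred_eq, Set.mem_empty_iff_false, iff_false]
      omega
    simp [this]
  | append_singleton w i ih =>
    rw [wordProd_concat, List.length_append, List.length_singleton, Nat.cast_add, Nat.cast_one]
    rcases lt_trichotomy (wordProd w i) (wordProd w (i + 1)) with h | h | h
    · rw [encard_inversions_mul h]
      gcongr
    · exact absurd ((wordProd w).injective h) (by omega)
    · rw [encard_inversions_of_gt h] at ih
      exact le_self_add.trans (ih.trans le_self_add)

/-- `w` is a word of `σ` with as many letters as `σ` has inversions. -/
def IsExactWord (w : List ℕ) (σ : Equiv.Perm ℕ) : Prop :=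
  wordProd w = σ ∧ (inversions σ).encard = w.length

theorem IsExactWord.isReducedWord {w : List ℕ} {σ : Equiv.Perm ℕ} (h : IsExactWord w σ) :
    IsReducedWord w σ := by
  refine ⟨h.1, fun v hv => ?_⟩
  have := encard_inversions_wordProd_le v
  rw [hv, h.2] at this
  exact_mod_cast this

theorem IsReducedWord.isExactWord {w v : List ℕ} {σ : Equiv.Perm ℕ} (h : IsReducedWord w σ)
    (hv : IsExactWord v σ) : IsExactWord w σ := by
  refine ⟨h.1, le_antisymm ?_ ?_⟩
  · rw [← h.1]
    exact encard_inversions_wordProd_le w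
  · rw [hv.2]
    exact_mod_cast h.2 v hv.1

theorem isExactWord_nil : IsExactWord [] 1 := by
  refine ⟨rfl, le_antisymm ?_ (by simp)⟩
  exact encard_inversions_wordProd_le []

theorem IsExactWord.concat {w : List ℕ} {τ : Equiv.Perm ℕ} {i : ℕ} (h : IsExactWord w τ)
    (hi : τ i < τ (i + 1)) : IsExactWord (w ++ [i]) (τ * simpleTransposition i) := by
  refine ⟨by rw [wordProd_concat, h.1], ?_⟩
  rw [encard_inversions_mul hi, h.2]
  simp

theorem IsExactWord.of_concat {w : List ℕ} {i : ℕ}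
    (h : IsExactWord (w ++ [i]) (wordProd (w ++ [i]))) :
    IsExactWord w (wordProd w) ∧ wordProd w i < wordProd w (i + 1) := by
  have h2 := h.2
  have hle := encard_inversions_wordProd_le w
  rw [wordProd_concat, List.length_append, List.length_singleton, Nat.cast_add, Nat.cast_one] at h2
  rcases lt_trichotomy (wordProd w i) (wordProd w (i + 1)) with hi | hi | hi
  · rw [encard_inversions_mul hi] at h2
    exact ⟨⟨rfl, (ENat.add_left_injective_of_ne_top (by simp)) h2⟩, hi⟩
  · exact absurd ((wordProd w).injective hi) (by omega)
  · rw [encard_inversions_of_gt hi, h2] at hle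
    norm_cast at hle
    omega

/-- Induction on the last letter of `w`, an ascent of the preceding product by exactness. The
subword itself need not be reduced. -/
theorem rank_wordProd_le {v w : List ℕ} (hw : IsExactWord w (wordProd w)) (hvw : v.Sublist w)
    (a b : ℕ) : rank (wordProd v) a b ≤ rank (wordProd w) a b := by
  induction w using List.reverseRecOn generalizing v a b with
  | nil => rw [List.sublist_nil.1 hvw]
  | append_singleton w i ih =>
    obtain ⟨hw', hi⟩ := hw.of_concat
    have e1 := rank_succ (wordProd w) i b
    have e2 := rank_succ (wordProd w) (i + 1) b
    obtain ⟨v', u, rfl, hv', hu⟩ := List.sublist_append_iff.1 hvw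
    rw [wordProd_concat]
    rcases List.sublist_singleton.1 hu with rfl | rfl
    · rw [List.append_nil]
      refine (ih hw' hv' a b).trans ?_
      by_cases ha : a = i + 1
      · rw [ha, rank_mul_simpleTransposition_succ]
        split_ifs at e1 ⊢ <;> omega
      · rw [rank_mul_simpleTransposition_of_ne _ ha]
    · rw [wordProd_concat]
      by_cases ha : a = i + 1
      · rw [ha, rank_mul_simpleTransposition_succ, rank_mul_simpleTransposition_succ]
        -- If `b` is at most the value of `w` at `i + 1`, row `i` suffices; otherwise positions `i`
        -- and `i + 1` of `w` do not count, and its row `i + 2` equals its row `i`.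
        have f1 := ih hw' hv' i b
        have f2 := ih hw' hv' (i + 1 + 1) b
        have f3 := rank_succ (wordProd v') i b
        have f4 := rank_succ (wordProd v') (i + 1) b
        split_ifs at * <;> omega
      · rw [rank_mul_simpleTransposition_of_ne _ ha, rank_mul_simpleTransposition_of_ne _ ha]
        exact ih hw' hv' a b

theorem BruhatLE.rankLE {π σ : Equiv.Perm ℕ} (h : BruhatLE π σ) (hσ : ∃ w, IsExactWord w σ) :
    RankLE π σ := by
  obtain ⟨v, w, hv, hw, hvw⟩ := h
  obtain ⟨w₀, hw₀⟩ := hσ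
  have hw' := hw.isExactWord hw₀
  rw [← hv.1, ← hw.1]
  rw [← hw.1] at hw'
  exact fun b => ⟨rank_wordProd_le hw' hvw _ _, rank_wordProd_le hw' hvw _ _⟩

/-! ### Backwards cycles and their products -/

theorem backwardCycle_of_notMem {B : Finset ℕ} {k : ℕ} (h : k ∉ B) : backwardCycle B k = k :=
  List.formPerm_apply_of_notMem (by rwa [Finset.mem_sort])

theorem backwardCycle_mem {B : Finset ℕ} {k : ℕ} (h : k ∈ B) : backwardCycle B k ∈ B := by
  rw [← Finset.mem_sort (· ≥ ·)] at h ⊢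
  exact List.formPerm_apply_mem_of_mem h

theorem backwardCycle_singleton (k : ℕ) : backwardCycle {k} = 1 := by
  simp [backwardCycle]

/-- Adding a new maximum to a block multiplies its backwards cycle by a transposition. -/
theorem backwardCycle_insert {B : Finset ℕ} {m z : ℕ} (hm : m ∈ B) (hmax : ∀ b ∈ B, b ≤ m)
    (hz : m < z) : backwardCycle (insert z B) = Equiv.swap z m * backwardCycle B := by
  have hzB : z ∉ B := fun h => (hmax z h).not_gt hz
  have hB : B.sort (· ≥ ·) = m :: (B.erase m).sort (· ≥ ·) := by
    conv_lhs => rw [← Finset.insert_erase hm]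
    exact Finset.sort_insert _ (fun b hb => hmax b (Finset.mem_of_mem_erase hb))
      (Finset.notMem_erase m B)
  unfold backwardCycle
  rw [Finset.sort_insert _ (fun b hb => (hmax b hb).trans hz.le) hzB, hB,
    List.formPerm_cons_cons]

/-- A backwards cycle sends every element to the next smaller one, and the minimum to
the maximum. -/
theorem backwardCycle_spec {B : Finset ℕ} {k j : ℕ} (hk : k ∈ B) (hj : j ∈ B) :
    (backwardCycle B k < k → j < k → j ≤ backwardCycle B k) ∧
      (k ≤ backwardCycle B k → k ≤ j ∧ j ≤ backwardCycle B k) := by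
  induction B using Finset.induction_on_max generalizing k j with
  | empty => simp at hk
  | insert z B hB ih =>
    rcases B.eq_empty_or_nonempty with rfl | hne
    · simp only [insert_empty_eq, Finset.mem_singleton] at hk hj ⊢
      subst hk hj
      rw [backwardCycle_singleton]
      simp
    · set m := B.max' hne with hm
      have hmB : m ∈ B := B.max'_mem hne
      have hmax : ∀ b ∈ B, b ≤ m := fun b hb => B.le_max' b hb
      have hmz : m < z := hB m hmB
      rw [backwardCycle_insert hmB hmax hmz, Equiv.Perm.mul_apply]
      rw [Finset.mem_insert] at hk hj
      by_cases hkz : k = z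
      · subst hkz
        rw [backwardCycle_of_notMem fun h => (hB k h).false, Equiv.swap_apply_left]
        refine ⟨fun _ hjk => hmax j (hj.resolve_left hjk.ne), fun h => absurd hmz h.not_gt⟩
      · have hkB := hk.resolve_left hkz
        have hmem := backwardCycle_mem hkB
        have hkz' := hB k hkB
        -- The element sent to the old maximum `m` is the old minimum; it is now sent to the new
        -- maximum `z`.
        by_cases hkm : backwardCycle B k = m
        · rw [hkm, Equiv.swap_apply_right]
          refine ⟨fun h => absurd h hkz'.not_gt, fun _ => ?_⟩
          rcases hj with rfl | hj
          · exact ⟨hkz'.le, le_rfl⟩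
          · have h1 := (ih hkB hj).2 (hkm ▸ hmax k hkB)
            exact ⟨h1.1, (hB j hj).le⟩
        · rw [Equiv.swap_apply_of_ne_of_ne (hB _ hmem).ne hkm]
          rcases hj with rfl | hj
          · refine ⟨fun _ h => absurd h hkz'.not_gt, fun h => ?_⟩
            exact absurd (le_antisymm (hmax _ hmem) ((ih hkB hmB).2 h).2) hkm
          · exact ih hkB hj

theorem blocksPerm_cons (B : Finset ℕ) (L : List (Finset ℕ)) :
    blocksPerm (B :: L) = backwardCycle B * blocksPerm L := by
  simp [blocksPerm]

theorem blocksPerm_append (L M : List (Finset ℕ)) :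
    blocksPerm (L ++ M) = blocksPerm L * blocksPerm M := by
  simp [blocksPerm]

theorem blocksPerm_of_notMem {L : List (Finset ℕ)} {k : ℕ} (h : ∀ B ∈ L, k ∉ B) :
    blocksPerm L k = k := by
  induction L with
  | nil => rfl
  | cons B L ih =>
    rw [blocksPerm_cons, Equiv.Perm.mul_apply, ih fun C hC => h C (List.mem_cons_of_mem _ hC),
      backwardCycle_of_notMem (h B List.mem_cons_self)]

theorem blocksPerm_of_mem {L : List (Finset ℕ)} (hL : L.Pairwise Disjoint) {B : Finset ℕ} {k : ℕ}
    (hB : B ∈ L) (hk : k ∈ B) : blocksPerm L k = backwardCycle B k := by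
  induction L with
  | nil => simp at hB
  | cons C L ih =>
    rw [List.pairwise_cons] at hL
    rw [blocksPerm_cons, Equiv.Perm.mul_apply]
    rcases List.mem_cons.1 hB with rfl | hB
    · rw [blocksPerm_of_notMem fun D hD hkD => Finset.disjoint_left.1 (hL.1 D hD) hk hkD]
    · rw [ih hL.2 hB, backwardCycle_of_notMem fun h =>
        Finset.disjoint_left.1 (hL.1 B hB) h (backwardCycle_mem hk)]

/-! ### Noncrossing labellings -/

/-- `σ` is the noncrossing permutation of the partition of `[n]` into the fibres of `β`. -/
structure IsNCLabelling (n : ℕ) (β : ℕ → ℕ) (σ : Equiv.Perm ℕ) : Prop where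
  noncrossing : ∀ {a b c d}, a < c → c < b → b < d → β a = β b → β c = β d → β a = β c
  eq_of_le : ∀ {k j}, n ≤ k → β j = β k → j = k
  label_apply : ∀ k, β (σ k) = β k
  le_apply : ∀ {k j}, σ k < k → β j = β k → j < k → j ≤ σ k
  bounds : ∀ {k j}, k ≤ σ k → β j = β k → k ≤ j ∧ j ≤ σ k

/-- `σ` is a noncrossing permutation of `[n]`. -/
def IsNC (n : ℕ) (σ : Equiv.Perm ℕ) : Prop := ∃ β, IsNCLabelling n β σ

/-- The last two fields say that a non-minimal element goes to its predecessor in the block and the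
minimum to the maximum, so the labels determine the permutation. -/
theorem IsNCLabelling.unique {n m : ℕ} {β : ℕ → ℕ} {σ τ : Equiv.Perm ℕ}
    (hσ : IsNCLabelling n β σ) (hτ : IsNCLabelling m β τ) : σ = τ := by
  ext k
  rcases lt_or_ge (σ k) k with h | h
  · rcases lt_or_ge (τ k) k with h' | h'
    · exact le_antisymm (hτ.le_apply h' (hσ.label_apply k) h) (hσ.le_apply h (hτ.label_apply k) h')
    · exact absurd (hτ.bounds h' (hσ.label_apply k)).1 h.not_ge
  · rcases lt_or_ge (τ k) k with h' | h'
    · exact absurd (hσ.bounds h (hτ.label_apply k)).1 h'.not_ge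
    · exact le_antisymm (hτ.bounds h' (hσ.label_apply k)).2 (hσ.bounds h (hτ.label_apply k)).2

theorem isNCLabelling_blocksPerm {n : ℕ} (P : Finpartition (Finset.range n)) {β : ℕ → ℕ}
    (hP : ∀ k < n, ∀ j, β j = β k ↔ j ∈ P.part k)
    (hle : ∀ {k j}, n ≤ k → β j = β k → j = k)
    (hnc : ∀ {a b c d}, a < c → c < b → b < d → β a = β b → β c = β d → β a = β c) :
    IsNCLabelling n β (blocksPerm P.parts.toList) := by
  have hdisj : P.parts.toList.Pairwise Disjoint :=
    P.parts.nodup_toList.pairwise_of_forall_ne fun B hB C hC hne =>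
      P.disjoint (Finset.mem_toList.1 hB) (Finset.mem_toList.1 hC) hne
  have hin : ∀ k < n, blocksPerm P.parts.toList k = backwardCycle (P.part k) k := fun k hk =>
    blocksPerm_of_mem hdisj (Finset.mem_toList.2 (P.part_mem.2 (Finset.mem_range.2 hk)))
      (P.mem_part (Finset.mem_range.2 hk))
  have hout : ∀ k, n ≤ k → blocksPerm P.parts.toList k = k := fun k hk =>
    blocksPerm_of_notMem fun B hB hkB => by
      have := P.le (Finset.mem_toList.1 hB) hkB
      rw [Finset.mem_range] at this
      omega
  refine ⟨hnc, hle, fun k => ?_, fun {k j} h hj hjk => ?_, fun {k j} h hj => ?_⟩ <;>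
    rcases lt_or_ge k n with hk | hk
  · rw [hin k hk, hP k hk]
    exact backwardCycle_mem (P.mem_part (Finset.mem_range.2 hk))
  · rw [hout k hk]
  · rw [hin k hk] at h ⊢
    exact (backwardCycle_spec (P.mem_part (Finset.mem_range.2 hk)) ((hP k hk j).1 hj)).1 h hjk
  · exact absurd (hle hk hj) hjk.ne
  · rw [hin k hk] at h ⊢
    exact (backwardCycle_spec (P.mem_part (Finset.mem_range.2 hk)) ((hP k hk j).1 hj)).2 h
  · rw [hout k hk, hle hk hj]
    exact ⟨le_rfl, le_rfl⟩

theorem mem_noncrossingPerms_iff {n : ℕ} {σ : Equiv.Perm ℕ} :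
    σ ∈ noncrossingPerms n ↔ IsNC n σ := by
  constructor
  · rintro ⟨P, hP, rfl⟩
    -- Blocks of `[n]` get even labels and the singletons outside `[n]` odd ones, so the two kinds
    -- never collide.
    have h1 : ∀ k < n, ∀ j, (if j < n then 2 * Encodable.encode (P.part j) else 2 * j + 1) =
        (if k < n then 2 * Encodable.encode (P.part k) else 2 * k + 1) ↔ j ∈ P.part k := by
      intro k hk j
      rw [if_pos hk]
      by_cases hj : j < n
      · rw [if_pos hj, P.mem_part_iff_part_eq_part (Finset.mem_range.2 hj) (Finset.mem_range.2 hk)]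
        simp
      · rw [if_neg hj]
        exact ⟨fun h => by omega, fun h =>
          absurd (Finset.mem_range.1 (P.part_subset k h)) hj⟩
    have h2 : ∀ {k j}, n ≤ k → (if j < n then 2 * Encodable.encode (P.part j) else 2 * j + 1) =
        (if k < n then 2 * Encodable.encode (P.part k) else 2 * k + 1) → j = k := by
      intro k j hk h
      rw [if_neg hk.not_gt] at h
      split_ifs at h <;> omega
    refine ⟨_, isNCLabelling_blocksPerm P h1 h2 fun {a b c d} hac hcb hbd hab hcd => ?_⟩
    have hd : d < n := lt_of_not_ge fun h => by have := h2 h hcd; omega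
    have hab' := (h1 b (by omega) a).1 hab
    have hcd' := (h1 d hd c).1 hcd
    have hmem : ∀ {k}, k < n → P.part k ∈ P.parts := fun hk => P.part_mem.2 (Finset.mem_range.2 hk)
    have hself : ∀ {k}, k < n → k ∈ P.part k := fun hk => P.mem_part (Finset.mem_range.2 hk)
    by_contra hne
    refine hP (P.part b) (hmem (by omega)) (P.part d) (hmem hd) (fun h => hne ?_) a hab' b
      (hself (by omega)) c hcd' d (hself hd) ⟨hac, hcb, hbd⟩
    rw [hab, hcd, if_pos (by omega), if_pos hd, h]
  · rintro ⟨β, hβ⟩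
    have : DecidableRel (Setoid.ker β) := fun a b => decEq (β a) (β b)
    obtain ⟨P, hPdef⟩ : ∃ P, P = Finpartition.ofSetSetoid (Setoid.ker β) (Finset.range n) :=
      ⟨_, rfl⟩
    have hpart : ∀ k < n, ∀ j, β j = β k ↔ j ∈ P.part k := by
      intro k hk j
      rw [hPdef, Finpartition.mem_part_ofSetSetoid_iff_rel, Finset.mem_range, Finset.mem_range,
        Setoid.ker_def]
      refine ⟨fun h => ⟨hk, lt_of_not_ge fun hj => ?_, h.symm⟩, fun h => h.2.2.symm⟩
      have := hβ.eq_of_le hj h.symm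
      omega
    refine ⟨P, fun B hB C hC hne a ha b hb c hc d hd h => hne ?_,
      hβ.unique (isNCLabelling_blocksPerm P hpart hβ.eq_of_le hβ.noncrossing)⟩
    have hlt : ∀ {D k}, D ∈ P.parts → k ∈ D → k < n := fun hD hk => Finset.mem_range.1 (P.le hD hk)
    have e1 : ∀ {D k}, D ∈ P.parts → k ∈ D → P.part k = D := fun hD hk => P.part_eq_of_mem hD hk
    have hab := (hpart b (hlt hB hb) a).2 (by rwa [e1 hB hb])
    have hcd := (hpart d (hlt hC hd) c).2 (by rwa [e1 hC hd])
    have hac := hβ.noncrossing h.1 h.2.1 h.2.2 hab hcd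
    have := (hpart c (hlt hC hc) a).1 hac
    rw [e1 hC hc] at this
    rw [← e1 hB ha, e1 hC this]

theorem isNC_one (n : ℕ) : IsNC n 1 :=
  ⟨id, fun _ _ _ h1 h2 => by simp only [id] at *; omega, fun _ h => h, fun _ => rfl,
    fun h => absurd h (lt_irrefl _), fun _ h => by simp only [id] at h; simp [h]⟩

/-- Insert `i` as a singleton block. -/
theorem IsNC.shiftPerm {n i : ℕ} {σ : Equiv.Perm ℕ} (h : IsNC n σ) (hi : i < n) :
    IsNC (n + 1) (shiftPerm i σ) := by
  obtain ⟨β, hβ⟩ := h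
  -- Old labels are raised by one, which keeps `0` free for the singleton block of `i`.
  let β' : ℕ → ℕ := fun k => if k = i then 0 else β (if k < i then k else k - 1) + 1
  have hself : β' i = 0 := by simp [β']
  have hskip : ∀ k, β' (skip i k) = β k + 1 := by
    intro k
    simp only [β', if_neg (skip_ne i k)]
    congr 2
    unfold skip
    split_ifs <;> omega
  have heq : ∀ {j}, β' j = β' i → j = i := by
    intro j h
    rcases eq_or_eq_skip i j with rfl | ⟨j, rfl⟩
    · rfl
    · rw [hself, hskip] at h; omega
  have heq' : ∀ {j k}, β' j = β' (skip i k) → ∃ m, j = skip i m ∧ β m = β k := by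
    intro j k h
    rcases eq_or_eq_skip i j with rfl | ⟨m, rfl⟩
    · rw [hself, hskip] at h; omega
    · exact ⟨m, rfl, by rw [hskip, hskip] at h; omega⟩
  have hlt : ∀ {a b}, skip i a < skip i b ↔ a < b := (skip_strictMono i).lt_iff_lt
  have hle : ∀ {a b}, skip i a ≤ skip i b ↔ a ≤ b := (skip_strictMono i).le_iff_le
  refine ⟨β', ⟨fun {a b c d} h1 h2 h3 h4 h5 => ?_, fun {k j} hk hj => ?_, fun k => ?_,
    fun {k j} h1 h2 h3 => ?_, fun {k j} h1 h2 => ?_⟩⟩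
  · rcases eq_or_eq_skip i b with rfl | ⟨b, rfl⟩
    · have := heq h4; omega
    rcases eq_or_eq_skip i d with rfl | ⟨d, rfl⟩
    · have := heq h5; omega
    obtain ⟨a, rfl, ha⟩ := heq' h4
    obtain ⟨c, rfl, hc⟩ := heq' h5
    rw [hskip, hskip, hβ.noncrossing (hlt.1 h1) (hlt.1 h2) (hlt.1 h3) ha hc]
  · rcases eq_or_eq_skip i k with rfl | ⟨k, rfl⟩
    · exact heq hj
    · obtain ⟨j, rfl, hj'⟩ := heq' hj
      have : n ≤ k := by unfold skip at hk; split_ifs at hk <;> omega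
      rw [hβ.eq_of_le this hj']
  · rcases eq_or_eq_skip i k with rfl | ⟨k, rfl⟩
    · rw [shiftPerm_self]
    · rw [shiftPerm_skip, hskip, hskip, hβ.label_apply]
  · rcases eq_or_eq_skip i k with rfl | ⟨k, rfl⟩
    · have := heq h2; omega
    · obtain ⟨j, rfl, hj⟩ := heq' h2
      rw [shiftPerm_skip] at h1 ⊢
      exact hle.2 (hβ.le_apply (hlt.1 h1) hj (hlt.1 h3))
  · rcases eq_or_eq_skip i k with rfl | ⟨k, rfl⟩
    · rw [heq h2, shiftPerm_self]; exact ⟨le_rfl, le_rfl⟩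
    · obtain ⟨j, rfl, hj⟩ := heq' h2
      rw [shiftPerm_skip] at h1 ⊢
      rw [hle, hle]
      exact hβ.bounds (hle.1 h1) hj

/-- Insert `i` into the block of `i + 1`. -/
theorem IsNC.shiftPerm_mul {n i : ℕ} {σ : Equiv.Perm ℕ} (h : IsNC n σ) (hi : i < n) :
    IsNC (n + 1) (DoubleForest.shiftPerm i σ * simpleTransposition i) := by
  obtain ⟨β, hβ⟩ := h
  -- This collapses `i` and `i + 1` to the old element `i`, so both inherit its label.
  let p : ℕ → ℕ := fun k => if k ≤ i then k else k - 1
  have hp : p i = i := by simp [p]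
  have hpskip : ∀ k, p (skip i k) = k := by
    intro k
    simp only [p, skip]
    split_ifs <;> omega
  have hpmono : ∀ {a b}, a < b → p a ≤ p b := by
    intro a b h
    simp only [p]
    split_ifs <;> omega
  have hlt : ∀ {a b}, skip i a < skip i b ↔ a < b := (skip_strictMono i).lt_iff_lt
  have hle : ∀ {a b}, skip i a ≤ skip i b ↔ a ≤ b := (skip_strictMono i).le_iff_le
  have hge : ∀ {a}, i ≤ skip i a ↔ i ≤ a := by
    intro a; rw [← not_lt, skip_lt_iff, not_lt]
  have happ : ∀ {k}, k ≠ i →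
      (DoubleForest.shiftPerm i σ * simpleTransposition i) (skip i k) = skip i (σ k) := by
    intro k hk
    have h1 : skip i k ≠ i + 1 := by
      unfold skip; split_ifs <;> omega
    rw [Equiv.Perm.mul_apply, simpleTransposition_of_ne (skip_ne i k) h1, shiftPerm_skip]
  have happi := shiftPerm_mul_simpleTransposition_self i σ
  have happi' : (DoubleForest.shiftPerm i σ * simpleTransposition i) (skip i i) = i := by
    rw [skip_of_le le_rfl, shiftPerm_mul_simpleTransposition_succ]
  refine ⟨β ∘ p, ⟨fun {a b c d} h1 h2 h3 h4 h5 => ?_, fun {k j} hk hj => ?_, fun k => ?_,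
    fun {k j} h1 h2 h3 => ?_, fun {k j} h1 h2 => ?_⟩⟩
  · simp only [Function.comp_apply] at *
    rcases (hpmono h1).eq_or_lt with e1 | e1
    · rw [e1]
    rcases (hpmono h2).eq_or_lt with e2 | e2
    · rw [h4, e2]
    rcases (hpmono h3).eq_or_lt with e3 | e3
    · rw [h4, h5, e3]
    exact hβ.noncrossing e1 e2 e3 h4 h5
  · simp only [Function.comp_apply] at hj
    have h1 : p k = k - 1 := by simp only [p]; rw [if_neg (by omega)]
    have h2 := hβ.eq_of_le (by omega : n ≤ p k) hj
    rw [h1] at h2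
    simp only [p] at h2
    split_ifs at h2 <;> omega
  · simp only [Function.comp_apply]
    rcases eq_or_eq_skip i k with rfl | ⟨k, rfl⟩
    · rw [happi, hpskip, hp, hβ.label_apply]
    · by_cases hk : k = i
      · rw [hk, happi', hpskip, hp]
      · rw [happ hk, hpskip, hpskip, hβ.label_apply]
  · simp only [Function.comp_apply] at h2
    rcases eq_or_eq_skip i k with hk | ⟨k, rfl⟩
    · rw [hk] at h1 h2 h3 ⊢
      rw [happi] at h1 ⊢
      rw [hp, ← skip_of_lt h3, hpskip] at h2
      rw [skip_lt_iff] at h1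
      rw [skip_of_lt h1]
      exact hβ.le_apply h1 h2 h3
    · by_cases hk : k = i
      · rw [hk, skip_of_le le_rfl] at h3
        rw [hk, happi']
        omega
      · rw [happ hk, hlt] at h1
        rw [happ hk]
        rw [hpskip] at h2
        rcases eq_or_eq_skip i j with rfl | ⟨j, rfl⟩
        · rw [hp] at h2
          have : j < k := by
            rcases lt_or_ge k j with h | h
            · rw [skip_of_lt h] at h3; omega
            · omega
          exact hge.2 (hβ.le_apply h1 h2 this)
        · rw [hpskip] at h2
          exact hle.2 (hβ.le_apply h1 h2 (hlt.1 h3))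
  · simp only [Function.comp_apply] at h2
    rcases eq_or_eq_skip i k with hk | ⟨k, rfl⟩
    · rw [hk] at h1 h2 ⊢
      rw [happi] at h1 ⊢
      rw [hp] at h2
      rcases eq_or_eq_skip i j with rfl | ⟨j, rfl⟩
      · exact ⟨le_rfl, h1⟩
      · rw [hpskip] at h2
        rw [hge, hle]
        exact hβ.bounds (hge.1 h1) h2
    · by_cases hk : k = i
      · rw [hk, happi', skip_of_le le_rfl] at h1
        omega
      · rw [happ hk] at h1 ⊢
        rw [hpskip] at h2
        rcases eq_or_eq_skip i j with rfl | ⟨j, rfl⟩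
        · rw [hp] at h2
          obtain ⟨h3, h4⟩ := hβ.bounds (hle.1 h1) h2
          refine ⟨?_, hge.2 h4⟩
          rw [skip_of_lt (by omega)]
          exact h3
        · rw [hpskip] at h2
          rw [hle, hle]
          exact hβ.bounds (hle.1 h1) h2

theorem IsNC.insertDesc {n i : ℕ} {σ : Equiv.Perm ℕ} (h : IsNC n σ) (hi : i < n) :
    IsNC (n + 1) (insertDesc i σ) := by
  unfold DoubleForest.insertDesc
  split_ifs
  · exact h.shiftPerm hi
  · exact h.shiftPerm_mul hi

theorem IsNC.insertAsc {n i : ℕ} {σ : Equiv.Perm ℕ} (h : IsNC n σ) (hi : i < n) :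
    IsNC (n + 1) (insertAsc i σ) := by
  unfold DoubleForest.insertAsc
  split_ifs
  · exact h.shiftPerm_mul hi
  · exact h.shiftPerm hi

theorem IsNC.apply_of_le {n k : ℕ} {σ : Equiv.Perm ℕ} (h : IsNC n σ) (hk : n ≤ k) : σ k = k := by
  obtain ⟨β, hβ⟩ := h
  exact hβ.eq_of_le hk (hβ.label_apply k)

/-- Delete `i` from a noncrossing permutation. -/
theorem IsNC.exists_eq_insertDesc {n i : ℕ} {σ : Equiv.Perm ℕ} (h : IsNC n σ) (h1 : i ≤ σ i)
    (h2 : σ (i + 1) ≤ i) :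
    ∃ m τ, n = m + 1 ∧ i < m ∧ σ = DoubleForest.insertDesc i τ ∧ IsNC m τ := by
  have hin : i + 1 < n := lt_of_not_ge fun hn => by
    have := h.apply_of_le hn
    omega
  obtain ⟨β, hβ⟩ := h
  have hstep : ∃ τ, σ = DoubleForest.insertDesc i τ ∧ (τ i < i ∨ (σ i = skip i (τ i) ∧
      β i = β (i + 1))) := by
    have hlab := hβ.label_apply (i + 1)
    -- If `σ (i + 1) = i`, then `i` is removed from the block of `i + 1`; if `σ (i + 1) < i`, it
    -- turns out that `i` is a singleton block.
    rcases h2.eq_or_lt with h2 | h2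
    · obtain ⟨τ, hτ⟩ := exists_eq_shiftPerm (i := i) (τ := σ * simpleTransposition i) (by simpa)
      have hσ : σ = DoubleForest.shiftPerm i τ * simpleTransposition i := by
        rw [← hτ, mul_assoc, simpleTransposition_mul_self, mul_one]
      have hi : σ i = skip i (τ i) := by rw [hσ, shiftPerm_mul_simpleTransposition_self]
      refine ⟨τ, ?_, Or.inr ⟨hi, by rw [← h2, hlab, h2]⟩⟩
      rw [DoubleForest.insertDesc, if_neg, ← hσ]
      rw [← skip_lt_iff, ← hi]
      exact h1.not_gt
    · have hne : β i ≠ β (i + 1) := by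
        intro he
        have := (hβ.bounds h1 (hlab.trans he.symm)).1
        omega
      -- Otherwise `σ i > i + 1`, and the pairs `σ (i + 1) < i + 1` and `i < σ i` would cross,
      -- although `i`, a block minimum, cannot share a block with `i + 1`.
      have hi : σ i = i := by
        by_contra hi
        have h3 : σ i ≠ i + 1 := by
          intro h3
          refine hne ?_
          rw [← h3, hβ.label_apply]
        refine hne ?_
        rw [← hlab]
        exact (hβ.noncrossing (b := i + 1) (d := σ i) h2 (Nat.lt_succ_self i) (by omega) hlab
          (hβ.label_apply i).symm).symm
      obtain ⟨τ, hτ⟩ := exists_eq_shiftPerm hi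
      have hlt : τ i < i := by
        rw [hτ, shiftPerm_succ_of_le _ le_rfl, skip_lt_iff] at h2
        exact h2
      exact ⟨τ, by rw [DoubleForest.insertDesc, if_pos hlt, hτ], Or.inl hlt⟩
  obtain ⟨τ, hτ, hi⟩ := hstep
  have happ : ∀ {k}, k ≠ i → σ (skip i k) = skip i (τ k) := fun hk => by
    rw [hτ, insertDesc_skip _ hk]
  have happ' : τ i < i → σ (skip i i) = skip i (τ i) := fun h => by
    rw [hτ, DoubleForest.insertDesc, if_pos h, shiftPerm_skip]
  have hlt : ∀ {a b}, skip i a < skip i b ↔ a < b := (skip_strictMono i).lt_iff_lt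
  have hle : ∀ {a b}, skip i a ≤ skip i b ↔ a ≤ b := (skip_strictMono i).le_iff_le
  have hge : ∀ {a}, i ≤ skip i a ↔ i ≤ a := by
    intro a; rw [← not_lt, skip_lt_iff, not_lt]
  have hsk : skip i i = i + 1 := skip_of_le le_rfl
  refine ⟨n - 1, τ, by omega, by omega, hτ, β ∘ skip i, ⟨fun {a b c d} g1 g2 g3 g4 g5 => ?_,
    fun {k j} hk hj => ?_, fun k => ?_, fun {k j} g1 g2 g3 => ?_, fun {k j} g1 g2 => ?_⟩⟩
  · exact hβ.noncrossing (hlt.2 g1) (hlt.2 g2) (hlt.2 g3) g4 g5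
  · refine (skip_strictMono i).injective (hβ.eq_of_le ?_ hj)
    rw [skip_of_le (by omega)]
    omega
  · simp only [Function.comp_apply]
    by_cases hk : k = i
    · subst hk
      rcases hi with hi | ⟨hi, hi'⟩
      · rw [← happ' hi, hβ.label_apply]
      · rw [← hi, hβ.label_apply, hsk, hi']
    · rw [← happ hk, hβ.label_apply]
  · have happk : σ (skip i k) = skip i (τ k) := by
      by_cases hk : k = i
      · subst hk; exact happ' g1
      · exact happ hk
    rw [← hlt, ← happk] at g1
    rw [← hle, ← happk]
    exact hβ.le_apply g1 g2 (hlt.2 g3)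
  · simp only [Function.comp_apply] at g2
    by_cases hk : k = i
    · subst hk
      rcases hi with hi | ⟨hi, hi'⟩
      · omega
      · rw [hsk, ← hi'] at g2
        have := hβ.bounds h1 g2
        rwa [hi, hle, hge] at this
    · rw [← hle, ← happ hk] at g1
      have := hβ.bounds g1 g2
      rwa [happ hk, hle, hle] at this

/-- Some `a` rises, hence is a block minimum sent to the maximum, and that maximum is sent down.
Take the first `k > a` that is sent down; the position before it works. -/
theorem IsNC.exists_descent {n : ℕ} {σ : Equiv.Perm ℕ} (h : IsNC n σ) (h1 : σ ≠ 1) :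
    ∃ i, i ≤ σ i ∧ σ (i + 1) ≤ i := by
  obtain ⟨β, hβ⟩ := h
  obtain ⟨a, ha⟩ : ∃ a, a < σ a := by
    by_contra! h
    exact h1 (eq_one_of_forall_le h)
  have hex : ∃ k, a < k ∧ σ k < k := by
    refine ⟨σ a, ha, lt_of_not_ge fun h => ?_⟩
    exact absurd (hβ.bounds h (hβ.label_apply a).symm).1 ha.not_ge
  obtain ⟨h2, h3⟩ := Nat.find_spec hex
  obtain ⟨i, hi⟩ : ∃ i, Nat.find hex = i + 1 := ⟨Nat.find hex - 1, by omega⟩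
  rw [hi] at h2 h3
  refine ⟨i, ?_, by omega⟩
  rcases Nat.lt_succ_iff_lt_or_eq.1 h2 with h4 | rfl
  · exact not_lt.1 fun h5 => Nat.find_min hex (m := i) (by omega) ⟨h4, h5⟩
  · exact ha.le

/-- The sum of the ranks next to the diagonal. -/
def rankSum (n : ℕ) (σ : Equiv.Perm ℕ) : ℕ :=
  ∑ b ∈ Finset.range n, (rank σ b b + rank σ (b + 1) b)

/-- Exactly one of the entries of row `i + 1` drops: the one on the diagonal if `i ≤ σ i`, the other
one if not. -/
theorem rankSum_insertAsc_lt {n i : ℕ} (hi : i + 1 < n) (σ : Equiv.Perm ℕ) :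
    rankSum n (insertAsc i σ) < rankSum n (insertDesc i σ) := by
  have hle := rankLE_insertAsc_insertDesc i σ
  have h1 := rank_insertAsc_diag i σ
  have h2 := rank_insertDesc_diag i σ
  have h3 := rank_succ σ i i
  by_cases h : i ≤ σ i
  · refine Finset.sum_lt_sum (fun b _ => Nat.add_le_add (hle b).1 (hle b).2)
      ⟨i + 1, Finset.mem_range.2 hi, Nat.add_lt_add_of_lt_of_le ?_ (hle _).2⟩
    rw [h1.2, h2.2, h3, if_pos h]
    omega
  · refine Finset.sum_lt_sum (fun b _ => Nat.add_le_add (hle b).1 (hle b).2)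
      ⟨i, Finset.mem_range.2 (by omega), Nat.add_lt_add_of_le_of_lt (hle _).1 ?_⟩
    rw [h1.1, h2.1, h3, if_neg h]
    omega

/-- Every noncrossing permutation is the identity or inserts a letter with a descent into a smaller
one, and the corresponding insertion with an ascent is again noncrossing. -/
@[elab_as_elim]
theorem IsNC.induction {motive : Equiv.Perm ℕ → Prop} (one : motive 1)
    (insert : ∀ n i σ, i < n → IsNC n σ → motive σ → motive (DoubleForest.insertAsc i σ) →
      motive (DoubleForest.insertDesc i σ)) {n : ℕ} {σ : Equiv.Perm ℕ} (h : IsNC n σ) :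
    motive σ := by
  induction n using Nat.strong_induction_on generalizing σ with
  | _ n ihn =>
    induction hs : rankSum n σ using Nat.strong_induction_on generalizing σ with
    | _ s ihs =>
      by_cases h1 : σ = 1
      · rw [h1]; exact one
      obtain ⟨i, h2, h3⟩ := h.exists_descent h1
      obtain ⟨m, τ, rfl, hi, rfl, hτ⟩ := h.exists_eq_insertDesc h2 h3
      -- The smaller permutation `τ` is covered by induction on `n`, the ascent insertion by
      -- induction on the rank sum at the same `n`.
      exact insert m i τ hi hτ (ihn m (Nat.lt_succ_self m) hτ)
        (ihs _ (hs ▸ rankSum_insertAsc_lt (by omega) τ) (hτ.insertAsc hi) rfl)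

/-! ### The noncrossing permutation of a tree -/

/-- The product of the backwards cycles of the blocks of a tree with leaves `k, k + 1, …`.
If the root of the tree is a right child, the block of its last leaf is left out. -/
def treePerm : Bool → BinaryTree Unit → ℕ → Equiv.Perm ℕ
  | _, .nil, _ => 1
  | false, .node _ l r, k =>
      Equiv.swap (k + l.numLeaves + r.numLeaves - 1) (k + l.numLeaves - 1) *
        (treePerm false l k * treePerm true r (k + l.numLeaves))
  | true, .node _ l r, k => treePerm false l k * treePerm true r (k + l.numLeaves)

/-- Whether the `i`-th leaf of a tree is a right child; the Boolean says whether the root is. -/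
def IsRightLeaf : Bool → BinaryTree Unit → ℕ → Prop
  | b, .nil, _ => b = true
  | _, .node _ l r, i =>
      if i < l.numLeaves then IsRightLeaf false l i else IsRightLeaf true r (i - l.numLeaves)

theorem isRightLeaf_node_of_lt {b : Bool} {l r : BinaryTree Unit} {i : ℕ} (h : i < l.numLeaves) :
    IsRightLeaf b (.node () l r) i ↔ IsRightLeaf false l i := by
  simp [IsRightLeaf, h]

theorem isRightLeaf_node_add (b : Bool) (l r : BinaryTree Unit) (i : ℕ) :
    IsRightLeaf b (.node () l r) (l.numLeaves + i) ↔ IsRightLeaf true r i := by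
  simp [IsRightLeaf]

theorem treePerm_true_last (T : BinaryTree Unit) (k : ℕ) :
    treePerm true T k (k + T.numLeaves - 1) = k + T.numLeaves - 1 ∧
      ∀ (b : Bool) (j : ℕ), j < k ∨ k + T.numLeaves ≤ j → treePerm b T k j = j := by
  induction T generalizing k with
  | nil => simp [treePerm]
  | node _ l r ihl ihr =>
    have hl := l.numLeaves_pos
    have hr := r.numLeaves_pos
    rw [numLeaves_node]
    constructor
    · rw [treePerm, Equiv.Perm.mul_apply, ← add_assoc, (ihr _).1, (ihl k).2 _ _ (by omega)]
    · intro b j hj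
      have h1 := (ihr (k + l.numLeaves)).2 true j (by omega)
      have h2 := (ihl k).2 false j (by omega)
      cases b
      · rw [treePerm, Equiv.Perm.mul_apply, Equiv.Perm.mul_apply, h1, h2,
          Equiv.swap_apply_of_ne_of_ne (by omega) (by omega)]
      · rw [treePerm, Equiv.Perm.mul_apply, h1, h2]

theorem treePerm_of_notMem {b : Bool} {T : BinaryTree Unit} {k j : ℕ}
    (h : j < k ∨ k + T.numLeaves ≤ j) : treePerm b T k j = j :=
  (treePerm_true_last T k).2 b j h

theorem treePerm_bounds (b : Bool) {T : BinaryTree Unit} {k j : ℕ} (h1 : k ≤ j)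
    (h2 : j < k + T.numLeaves) : k ≤ treePerm b T k j ∧ treePerm b T k j < k + T.numLeaves := by
  by_contra h
  have := (treePerm b T k).injective (treePerm_of_notMem (b := b) (T := T) (k := k)
    (j := treePerm b T k j) (by omega))
  omega

/-- Moving a tree one place to the right is inserting a fixed point anywhere at or before its first
leaf. -/
theorem treePerm_succ {i k : ℕ} (h : i ≤ k) (b : Bool) (T : BinaryTree Unit) :
    treePerm b T (k + 1) = shiftPerm i (treePerm b T k) := by
  induction T generalizing k b with
  | nil => simp [treePerm]
  | node _ l r ihl ihr =>
    have hl := l.numLeaves_pos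
    have e : k + 1 + l.numLeaves = k + l.numLeaves + 1 := by omega
    cases b
    · simp only [treePerm, map_mul, shiftPerm_swap]
      rw [ihl h, e, ihr (by omega), skip_of_le (by omega), skip_of_le (by omega)]
      congr 2 <;> omega
    · simp only [treePerm, map_mul]
      rw [ihl h, e, ihr (by omega)]

theorem shiftPerm_treePerm {i k : ℕ} (b : Bool) {T : BinaryTree Unit} (h : k + T.numLeaves ≤ i) :
    shiftPerm i (treePerm b T k) = treePerm b T k := by
  symm
  apply eq_shiftPerm
  · exact treePerm_of_notMem (Or.inr h)
  · intro j
    rcases lt_or_ge j i with hj | hj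
    · rw [skip_of_lt hj, skip_of_lt]
      by_cases hj' : j < k ∨ k + T.numLeaves ≤ j
      · rwa [treePerm_of_notMem hj']
      · exact (treePerm_bounds b (by omega) (by omega)).2.trans_le h
    · rw [skip_of_le hj, treePerm_of_notMem (Or.inr (by omega)),
        treePerm_of_notMem (Or.inr (by omega)), skip_of_le hj]

theorem simpleTransposition_mul_comm {i : ℕ} {ρ : Equiv.Perm ℕ} (h : ρ i = i)
    (h' : ρ (i + 1) = i + 1) : simpleTransposition i * ρ = ρ * simpleTransposition i := by
  have := Equiv.mul_swap_eq_swap_mul ρ i (i + 1)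
  rw [h, h'] at this
  exact this.symm

theorem simpleTransposition_mul_shiftPerm {i : ℕ} {ρ : Equiv.Perm ℕ} (h : ρ i = i) :
    simpleTransposition i * shiftPerm i ρ = shiftPerm i ρ * simpleTransposition i :=
  simpleTransposition_mul_comm (shiftPerm_self i ρ)
    (by rw [shiftPerm_succ_of_le _ le_rfl, h, skip_of_le le_rfl])

-- A node grafted on a right leaf is itself a right child, so its left leaf is cut off and becomes a
-- singleton block; on any other leaf the new leaf `k + i` stays in the block of its right sibling.
open Classical in
theorem treePerm_graftTree (b : Bool) {T : BinaryTree Unit} {i : ℕ} (h : i < T.numLeaves) (k : ℕ) :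
    treePerm b (graftTree T i) k = if IsRightLeaf b T i then shiftPerm (k + i) (treePerm b T k)
      else shiftPerm (k + i) (treePerm b T k) * simpleTransposition (k + i) := by
  induction T generalizing b i k with
  | nil =>
    obtain rfl : i = 0 := by rw [numLeaves_nil] at h; omega
    cases b
    · simp [treePerm, graftTree, IsRightLeaf, simpleTransposition, Equiv.swap_comm]
    · simp [treePerm, graftTree, IsRightLeaf]
  | node _ l r ihl ihr =>
    have hl := l.numLeaves_pos
    have hr := r.numLeaves_pos
    rw [numLeaves_node] at h
    rcases lt_or_ge i l.numLeaves with hi | hi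
    · have hleft : treePerm false (graftTree l i) k *
            treePerm true r (k + (graftTree l i).numLeaves) =
          if IsRightLeaf false l i then
            shiftPerm (k + i) (treePerm false l k * treePerm true r (k + l.numLeaves))
          else shiftPerm (k + i) (treePerm false l k * treePerm true r (k + l.numLeaves)) *
            simpleTransposition (k + i) := by
        have e : k + (l.numLeaves + 1) = k + l.numLeaves + 1 := by omega
        rw [numLeaves_graftTree hi, e, treePerm_succ (i := k + i) (by omega), ihl false hi, map_mul]
        split_ifs
        · rfl
        · rw [mul_assoc, mul_assoc, simpleTransposition_mul_shiftPerm]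
          exact treePerm_of_notMem (Or.inl (by omega))
      rw [graftTree_node_of_lt hi, if_congr (isRightLeaf_node_of_lt hi) rfl rfl]
      cases b
      · simp only [treePerm]
        rw [hleft, map_mul (shiftPerm (k + i)) (Equiv.swap _ _), shiftPerm_swap,
          numLeaves_graftTree hi, skip_of_le (by omega), skip_of_le (by omega),
          show k + (l.numLeaves + 1) + r.numLeaves - 1 = k + l.numLeaves + r.numLeaves - 1 + 1 by
            omega,
          show k + (l.numLeaves + 1) - 1 = k + l.numLeaves - 1 + 1 by omega]
        split_ifs
        · rfl
        · rw [mul_assoc]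
      · simp only [treePerm]
        exact hleft
    · obtain ⟨i, rfl⟩ := Nat.exists_eq_add_of_le hi
      have hi' : i < r.numLeaves := by omega
      have hright : treePerm false l k * treePerm true (graftTree r i) (k + l.numLeaves) =
          if IsRightLeaf true r i then shiftPerm (k + (l.numLeaves + i))
            (treePerm false l k * treePerm true r (k + l.numLeaves))
          else shiftPerm (k + (l.numLeaves + i))
            (treePerm false l k * treePerm true r (k + l.numLeaves)) *
            simpleTransposition (k + (l.numLeaves + i)) := by
        rw [ihr true hi', map_mul, shiftPerm_treePerm false (T := l) (by omega), ← add_assoc]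
        split_ifs
        · rfl
        · rw [mul_assoc]
      rw [graftTree_node_add, if_congr (isRightLeaf_node_add b l r i) rfl rfl]
      cases b
      · simp only [treePerm]
        rw [hright, map_mul (shiftPerm (k + (l.numLeaves + i))) (Equiv.swap _ _), shiftPerm_swap,
          numLeaves_graftTree hi', skip_of_le (by omega), skip_of_lt (by omega),
          show k + l.numLeaves + (r.numLeaves + 1) - 1 = k + l.numLeaves + r.numLeaves - 1 + 1 by
            omega]
        split_ifs
        · rfl
        · rw [mul_assoc]
      · simp only [treePerm]
        exact hright

/-- The right leaves are the non-minimal elements of their blocks. The exception for the last leaf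
arises because `treePerm true` leaves out its block and so fixes it. -/
theorem isRightLeaf_iff {T : BinaryTree Unit} {i : ℕ} (h : i < T.numLeaves) (k : ℕ) :
    (IsRightLeaf false T i ↔ treePerm false T k (k + i) < k + i) ∧
      (IsRightLeaf true T i ↔ i + 1 = T.numLeaves ∨ treePerm true T k (k + i) < k + i) := by
  induction T generalizing i k with
  | nil =>
    rw [numLeaves_nil] at h ⊢
    obtain rfl : i = 0 := by omega
    simp [IsRightLeaf, treePerm]
  | node _ l r ihl ihr =>
    have hl := l.numLeaves_pos
    have hr := r.numLeaves_pos
    rw [numLeaves_node] at h ⊢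
    rcases lt_or_ge i l.numLeaves with hi | hi
    · have hr' : treePerm true r (k + l.numLeaves) (k + i) = k + i :=
        treePerm_of_notMem (Or.inl (by omega))
      have hb := treePerm_bounds false (T := l) (k := k) (j := k + i) (by omega) (by omega)
      rw [isRightLeaf_node_of_lt hi, isRightLeaf_node_of_lt hi, (ihl hi k).1]
      simp only [treePerm, Equiv.Perm.mul_apply, hr']
      constructor
      · by_cases hv : treePerm false l k (k + i) = k + l.numLeaves - 1
        · rw [hv, Equiv.swap_apply_right]; omega
        · rw [Equiv.swap_apply_of_ne_of_ne (by omega) hv]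
      · omega
    · obtain ⟨i, rfl⟩ := Nat.exists_eq_add_of_le hi
      have hi' : i < r.numLeaves := by omega
      have hb := treePerm_bounds true (T := r) (k := k + l.numLeaves) (j := k + l.numLeaves + i)
        (by omega) (by omega)
      have hl' : treePerm false l k (treePerm true r (k + l.numLeaves) (k + l.numLeaves + i)) =
          treePerm true r (k + l.numLeaves) (k + l.numLeaves + i) :=
        treePerm_of_notMem (Or.inr hb.1)
      rw [isRightLeaf_node_add, isRightLeaf_node_add, (ihr hi' (k + l.numLeaves)).2, ← add_assoc]
      simp only [treePerm, Equiv.Perm.mul_apply, hl']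
      constructor
      · have hlast := (treePerm_true_last r (k + l.numLeaves)).1
        by_cases hv : i + 1 = r.numLeaves
        · have e : k + l.numLeaves + i = k + l.numLeaves + r.numLeaves - 1 := by omega
          rw [e, hlast, Equiv.swap_apply_left]
          omega
        · have hne : treePerm true r (k + l.numLeaves) (k + l.numLeaves + i) ≠
              k + l.numLeaves + r.numLeaves - 1 := by
            intro he
            rw [← hlast] at he
            have := (treePerm true r (k + l.numLeaves)).injective he
            omega
          rw [Equiv.swap_apply_of_ne_of_ne hne (by omega)]
          omega
      · omega

theorem treePerm_false_graftTree {T : BinaryTree Unit} {i : ℕ} (h : i < T.numLeaves) (k : ℕ) :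
    treePerm false (graftTree T i) k = insertDesc (k + i) (treePerm false T k) := by
  classical
  rw [treePerm_graftTree false h, insertDesc]
  exact if_congr (isRightLeaf_iff h k).1 rfl rfl

/-! ### The noncrossing permutation of a forest -/

namespace IndexedForest

/-- The product of the noncrossing permutations of the first `N` trees. -/
def partialPerm (F : IndexedForest) : ℕ → Equiv.Perm ℕ
  | 0 => 1
  | N + 1 => F.partialPerm N * treePerm false (F.tree N) (F.start N)

theorem partialPerm_of_le (F : IndexedForest) {N k : ℕ} (h : F.start N ≤ k) :
    F.partialPerm N k = k := by
  induction N with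
  | zero => rfl
  | succ N ih =>
    have := F.start_succ N
    rw [partialPerm, Equiv.Perm.mul_apply, treePerm_of_notMem (Or.inr (by omega)), ih (by omega)]

/-- The trees before leaf `i` are unaffected, the tree containing it undergoes the insertion, and
those after it are shifted, which commutes with the transposition at `i`. -/
theorem partialPerm_graft (F : IndexedForest) (i N : ℕ) :
    (F.graft i).partialPerm N = if i < F.start N then insertDesc i (F.partialPerm N)
      else shiftPerm i (F.partialPerm N) := by
  induction N with
  | zero => simp [partialPerm]
  | succ N ih =>
    have hs := F.start_succ N
    rw [partialPerm, ih, partialPerm]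
    rcases lt_or_ge i (F.start N) with h | h
    · have hi : treePerm false (F.tree N) (F.start N) i = i := treePerm_of_notMem (Or.inl h)
      rw [if_pos h, if_pos (by omega), graft_tree_of_lt h, start_graft_of_lt h, treePerm_succ h.le]
      unfold insertDesc
      rw [Equiv.Perm.mul_apply, hi, map_mul]
      split_ifs
      · rfl
      · rw [mul_assoc, mul_assoc, simpleTransposition_mul_shiftPerm hi]
    · rw [if_neg h.not_gt, start_graft_of_le h]
      rcases lt_or_ge i (F.start (N + 1)) with h' | h'
      · rw [if_pos h', graft_tree_of_le_lt h, treePerm_false_graftTree (by omega),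
          Nat.add_sub_cancel' h]
        unfold insertDesc
        have hb := treePerm_bounds false (T := F.tree N) h (by omega)
        rw [Equiv.Perm.mul_apply, F.partialPerm_of_le hb.1, map_mul]
        split_ifs
        · rfl
        · rw [mul_assoc]
      · rw [if_neg h'.not_gt, graft_tree_of_le h', map_mul,
          shiftPerm_treePerm false (by omega)]

/-- The noncrossing permutation of a forest. -/
noncomputable def perm (F : IndexedForest) : Equiv.Perm ℕ :=
  F.partialPerm F.exists_forall_tree_eq_nil.choose

theorem partialPerm_add_of_nil {F : IndexedForest} {N : ℕ} (h : ∀ j, N ≤ j → F.tree j = .nil)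
    (d : ℕ) : F.partialPerm (N + d) = F.partialPerm N := by
  induction d with
  | zero => rfl
  | succ d ih =>
    rw [← add_assoc, partialPerm, ih, h _ (by omega), treePerm]
    rfl

theorem perm_eq_partialPerm {F : IndexedForest} {N : ℕ} (h : ∀ j, N ≤ j → F.tree j = .nil) :
    F.perm = F.partialPerm N := by
  have h1 := partialPerm_add_of_nil F.exists_forall_tree_eq_nil.choose_spec N
  have h2 := partialPerm_add_of_nil h F.exists_forall_tree_eq_nil.choose
  rw [add_comm] at h2
  rw [perm, ← h1, h2]

theorem perm_empty : perm empty = 1 := perm_eq_partialPerm (N := 0) fun _ _ => rfl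

theorem perm_graft (F : IndexedForest) (i : ℕ) : (F.graft i).perm = insertDesc i F.perm := by
  obtain ⟨N, hN⟩ := F.exists_forall_tree_eq_nil
  obtain ⟨M, hM⟩ := (F.graft i).exists_forall_tree_eq_nil
  have := F.le_start (N + M + i + 1)
  rw [perm_eq_partialPerm (N := N + M + i + 1) fun j hj => hM j (by omega),
    perm_eq_partialPerm (N := N + M + i + 1) fun j hj => hN j (by omega), partialPerm_graft,
    if_pos (by omega)]

/-- Induction on grafting at `j`: for `i ≠ j` the descent already exists before insertion of `j`,
and the terminal node found there survives because grafts commute. The neighbouring cases `i + 1 =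
j` and `i = j + 1` contradict the values of `insertDesc` at `j` and `j + 1`. -/
theorem mem_qDes_of_perm {F : IndexedForest} {i : ℕ} (h1 : i ≤ F.perm i)
    (h2 : F.perm (i + 1) ≤ i) : i ∈ F.qDes := by
  induction F using graft_induction generalizing i with
  | empty => rw [perm_empty] at h2; simp at h2
  | graft G j ih =>
    rw [perm_graft] at h1 h2
    have hself := insertDesc_self_ge j G.perm
    have hsucc := insertDesc_succ_le j G.perm
    rcases lt_trichotomy i j with hij | rfl | hij
    · have hij' : i + 1 < j := by
        rcases Nat.lt_or_eq_of_le (show i + 1 ≤ j from hij) with h | rfl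
        · exact h
        · omega
      have e1 := insertDesc_skip G.perm (i := j) (k := i) (by omega)
      have e2 := insertDesc_skip G.perm (i := j) (k := i + 1) (by omega)
      rw [skip_of_lt hij] at e1
      rw [skip_of_lt hij'] at e2
      rw [e1] at h1
      rw [e2] at h2
      have hG : i ∈ G.qDes := by
        apply ih <;> unfold skip at h1 h2 <;> split_ifs at h1 h2 <;> omega
      obtain ⟨H, rfl⟩ := mem_qDes_iff.1 hG
      obtain ⟨a, rfl⟩ : ∃ a, j = a + 1 := ⟨j - 1, by omega⟩
      rw [← graft_graft H (by omega : i < a)]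
      exact mem_qDes_graft _ _
    · exact mem_qDes_graft _ _
    · obtain ⟨m, rfl⟩ : ∃ m, i = m + 1 := ⟨i - 1, by omega⟩
      have hm : j < m := by
        rcases Nat.lt_or_eq_of_le (show j ≤ m by omega) with h | rfl
        · exact h
        · omega
      have e1 := insertDesc_skip G.perm (i := j) (k := m) (by omega)
      have e2 := insertDesc_skip G.perm (i := j) (k := m + 1) (by omega)
      rw [skip_of_le (by omega : j ≤ m)] at e1
      rw [skip_of_le (by omega : j ≤ m + 1)] at e2
      rw [e1] at h1
      rw [e2] at h2
      have hG : m ∈ G.qDes := by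
        apply ih <;> unfold skip at h1 h2 <;> split_ifs at h1 h2 <;> omega
      obtain ⟨H, rfl⟩ := mem_qDes_iff.1 hG
      rw [graft_graft H hm]
      exact mem_qDes_graft _ _

/-- The last graft of `F` shows in its permutation, so `G` is also a graft at `i`, and `insertDesc
i` can be cancelled. -/
theorem perm_injective : Function.Injective perm := by
  intro F
  induction F using graft_induction with
  | empty =>
    intro G hG
    by_contra hne
    obtain ⟨i, hi⟩ := exists_mem_qDes (Ne.symm hne)
    obtain ⟨H, rfl⟩ := mem_qDes_iff.1 hi
    have := insertDesc_succ_le i H.perm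
    rw [← perm_graft, ← hG, perm_empty] at this
    simp at this
  | graft F i ih =>
    intro G hG
    have hi : i ∈ G.qDes := by
      apply mem_qDes_of_perm
      · rw [← hG, perm_graft]; exact insertDesc_self_ge i _
      · rw [← hG, perm_graft]; exact insertDesc_succ_le i _
    obtain ⟨H, rfl⟩ := mem_qDes_iff.1 hi
    rw [perm_graft, perm_graft] at hG
    rw [ih (insertDesc_injective i hG)]

theorem isNC_perm {F : IndexedForest} {n : ℕ} (hF : F ∈ forestsOn n) : IsNC n F.perm := by
  induction F using graft_induction generalizing n with
  | empty => rw [perm_empty]; exact isNC_one n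
  | graft F i ih =>
    have hi := lt_of_graft_mem_forestsOn hF
    obtain ⟨m, rfl⟩ : ∃ m, n = m + 1 := ⟨n - 1, by omega⟩
    rw [perm_graft]
    exact (ih (mem_forestsOn_of_graft hF)).insertDesc (by omega)

end IndexedForest

theorem IsNC.exists_perm_eq {n : ℕ} {σ : Equiv.Perm ℕ} (h : IsNC n σ) :
    ∃ F ∈ forestsOn n, F.perm = σ := by
  induction n using Nat.strong_induction_on generalizing σ with
  | _ n ih =>
    by_cases h1 : σ = 1
    · exact ⟨IndexedForest.empty, empty_mem_forestsOn n, by rw [h1, IndexedForest.perm_empty]⟩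
    obtain ⟨i, h2, h3⟩ := h.exists_descent h1
    obtain ⟨m, τ, rfl, hi, rfl, hτ⟩ := h.exists_eq_insertDesc h2 h3
    obtain ⟨G, hG, rfl⟩ := ih m (Nat.lt_succ_self m) hτ
    exact ⟨G.graft i, graft_mem_forestsOn hG hi, G.perm_graft i⟩

/-! ### Comparison with the blocks of the forest -/

/-- A right child ends up as just its last leaf; the block of any other root has that leaf as its
maximum. Hence passing to the parent adds a new maximum to the block of its left child. -/
theorem mem_leaves_labelTree (T : BinaryTree Unit) (k : ℕ) :
    ((cutLeftEdges true (labelTree T k)).1.leaves = {k + T.numLeaves - 1} ∧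
      k + T.numLeaves - 1 ∈ (cutLeftEdges false (labelTree T k)).1.leaves ∧
      ∀ b ∈ (cutLeftEdges false (labelTree T k)).1.leaves, b ≤ k + T.numLeaves - 1) ∧
    ∀ (c : Bool), ∀ B ∈ (cutLeftEdges c (labelTree T k)).1 :: (cutLeftEdges c (labelTree T k)).2,
      ∀ b ∈ B.leaves, k ≤ b ∧ b < k + T.numLeaves := by
  induction T generalizing k with
  | nil => simp [labelTree, cutLeftEdges, LabelledTree.leaves]
  | node _ l r ihl ihr =>
    have hl := l.numLeaves_pos
    have hr := r.numLeaves_pos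
    obtain ⟨⟨l1, l2, l3⟩, l4⟩ := ihl k
    obtain ⟨⟨r1, r2, r3⟩, r4⟩ := ihr (k + l.numLeaves)
    rw [numLeaves_node]
    refine ⟨⟨?_, ?_, ?_⟩, ?_⟩
    · simp only [labelTree, cutLeftEdges]
      rw [r1, add_assoc]
    · simp only [labelTree, cutLeftEdges, LabelledTree.leaves]
      rw [r1, add_assoc]
      simp
    · simp only [labelTree, cutLeftEdges, LabelledTree.leaves]
      rw [r1]
      intro b hb
      rcases Finset.mem_union.1 hb with hb | hb
      · have := l3 b hb; omega
      · rw [Finset.mem_singleton] at hb; omega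
    · have hL : ∀ B ∈ (cutLeftEdges false (labelTree l k)).1 ::
            (cutLeftEdges false (labelTree l k)).2,
          ∀ b ∈ B.leaves, k ≤ b ∧ b < k + (l.numLeaves + r.numLeaves) := by
        intro B hB b hb
        have := l4 false B hB b hb
        omega
      have hR : ∀ B ∈ (cutLeftEdges true (labelTree r (k + l.numLeaves))).1 ::
            (cutLeftEdges true (labelTree r (k + l.numLeaves))).2,
          ∀ b ∈ B.leaves, k ≤ b ∧ b < k + (l.numLeaves + r.numLeaves) := by
        intro B hB b hb
        have := r4 true B hB b hb
        omega
      rw [List.forall_mem_cons] at hL hR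
      intro c
      cases c
      · simp only [labelTree, cutLeftEdges, List.forall_mem_cons, List.forall_mem_append]
        refine ⟨?_, hL.2, hR.2⟩
        intro b hb
        rcases Finset.mem_union.1 hb with hb | hb
        exacts [hL.1 b hb, hR.1 b hb]
      · simp only [labelTree, cutLeftEdges, List.forall_mem_cons, List.forall_mem_append]
        exact ⟨hR.1, hL.1, hL.2, hR.2⟩

/-- The root block grows by one new maximum, the last leaf on the right, which multiplies its cycle
by the transposition in `treePerm`. -/
theorem blocksPerm_cutLeftEdges (T : BinaryTree Unit) (k : ℕ) :
    blocksPerm (((cutLeftEdges false (labelTree T k)).1 ::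
        (cutLeftEdges false (labelTree T k)).2).map LabelledTree.leaves) = treePerm false T k ∧
      blocksPerm ((cutLeftEdges true (labelTree T k)).2.map LabelledTree.leaves) =
        treePerm true T k := by
  induction T generalizing k with
  | nil =>
    simp [labelTree, cutLeftEdges, LabelledTree.leaves, treePerm, blocksPerm,
      backwardCycle_singleton]
  | node _ l r ihl ihr =>
    have hl := l.numLeaves_pos
    have hr := r.numLeaves_pos
    have h1 := (ihl k).1
    have h2 := (ihr (k + l.numLeaves)).2
    rw [List.map_cons, blocksPerm_cons] at h1
    obtain ⟨-, l2, l3⟩ := (mem_leaves_labelTree l k).1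
    have r1 := (mem_leaves_labelTree r (k + l.numLeaves)).1.1
    constructor
    · simp only [labelTree, cutLeftEdges, LabelledTree.leaves, treePerm, List.map_cons,
        List.map_append, blocksPerm_cons, blocksPerm_append]
      rw [r1, Finset.union_singleton, backwardCycle_insert l2 l3 (by omega), h2, ← h1]
      simp only [mul_assoc]
    · simp only [labelTree, cutLeftEdges, treePerm, List.map_cons, List.map_append,
        blocksPerm_cons, blocksPerm_append]
      rw [h2, ← h1, mul_assoc]

theorem blocksPerm_filter {L : List (Finset ℕ)} {p : Finset ℕ → Prop} [DecidablePred p]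
    (h : ∀ B ∈ L, ¬ p B → backwardCycle B = 1) : blocksPerm (L.filter (p ·)) = blocksPerm L := by
  induction L with
  | nil => rfl
  | cons B L ih =>
    rw [List.forall_mem_cons] at h
    rw [List.filter_cons]
    split_ifs with hB
    · rw [blocksPerm_cons, blocksPerm_cons, ih h.2]
    · rw [blocksPerm_cons, ih h.2, h.1 (by simpa using hB), one_mul]

theorem forToNC_eq_perm {n : ℕ} {F : IndexedForest} (hF : F ∈ forestsOn n) :
    F.forToNC n = F.perm := by
  rw [mem_forestsOn] at hF
  have hnil : ∀ j, n ≤ j → F.tree j = .nil := by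
    intro j hj
    by_contra h
    have := hF j h
    have := F.le_start (j + 1)
    omega
  rw [IndexedForest.perm_eq_partialPerm hnil, IndexedForest.forToNC, IndexedForest.lcBlocks,
    blocksPerm_filter]
  · have key : ∀ N, blocksPerm (((List.range N).flatMap F.lcTrees).map LabelledTree.leaves) =
        F.partialPerm N := by
      intro N
      induction N with
      | zero => rfl
      | succ N ih =>
        rw [List.range_succ, List.flatMap_append, List.map_append, blocksPerm_append, ih,
          IndexedForest.partialPerm, List.flatMap_singleton, IndexedForest.lcTrees,
          (blocksPerm_cutLeftEdges _ _).1]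
    exact key n
  -- Nontrivial trees lie within `[n]`, so any block that is filtered out is a singleton and has a
  -- trivial cycle.
  · intro B hB hsub
    obtain ⟨T, hT, rfl⟩ := List.mem_map.1 hB
    obtain ⟨j, -, hj⟩ := List.mem_flatMap.1 hT
    by_cases hnil : F.tree j = .nil
    · rw [IndexedForest.lcTrees, hnil] at hj
      simp only [labelTree, cutLeftEdges, List.mem_cons, List.not_mem_nil, or_false] at hj
      rw [hj, LabelledTree.leaves, backwardCycle_singleton]
    · refine absurd (fun b hb => ?_) hsub
      have h1 := (mem_leaves_labelTree (F.tree j) (F.start j)).2 false T hj b hb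
      have h2 := hF j hnil
      rw [F.start_succ] at h2
      exact Finset.mem_range.2 (by omega)

theorem bijOn_forToNC (n : ℕ) :
    Set.BijOn (IndexedForest.forToNC n) (forestsOn n) (noncrossingPerms n) := by
  refine ⟨fun F hF => ?_, fun F hF G hG h => ?_, fun σ hσ => ?_⟩
  · rw [forToNC_eq_perm hF, mem_noncrossingPerms_iff]
    exact IndexedForest.isNC_perm hF
  · rw [forToNC_eq_perm hF, forToNC_eq_perm hG] at h
    exact IndexedForest.perm_injective h
  · obtain ⟨F, hF, rfl⟩ := (mem_noncrossingPerms_iff.1 hσ).exists_perm_eq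
    exact ⟨F, hF, forToNC_eq_perm hF⟩

/-! ### Evaluations at noncrossing permutations -/

theorem ev_x (σ : Equiv.Perm ℕ) (j : ℕ) : ev σ (x j) = X (σ j) := by simp [ev, x]

theorem ev_t (σ : Equiv.Perm ℕ) (j : ℕ) : ev σ (t j) = X j := by simp [ev, t]

theorem ev_shiftPerm_mul_sub {i : ℕ} {f g : PolTX} (h : equivariantTrim i f = omitT i g)
    (σ : Equiv.Perm ℕ) :
    ev (shiftPerm i σ * simpleTransposition i) f - ev (shiftPerm i σ) f =
      (X (skip i (σ i)) - X i) * rename (skip i) (ev σ g) := by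
  -- Sending `x_k` to `t_{skip i (σ k)}` turns inserting `t i` among the variables into inserting
  -- the letter `i` among the values of `σ`; the claim is the image of the defining equation of
  -- `E_i`.
  let φ : PolTX →ₐ[ℤ] MvPolynomial ℕ ℤ := aeval (Sum.elim (fun k => X (skip i (σ k))) X)
  have hx : ∀ j, φ (x j) = X (skip i (σ j)) := fun j => by simp [φ, x]
  have ht : ∀ j, φ (t j) = X j := fun j => by simp [φ, t]
  have h1 : φ.comp (insertT i i) = ev (shiftPerm i σ) := by
    apply algHom_ext_xt
    · intro j
      rw [AlgHom.comp_apply, insertT_x, ev_x]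
      rcases lt_trichotomy j i with hj | rfl | hj
      · rw [if_pos hj, hx, shiftPerm_of_lt _ hj]
      · rw [if_neg (lt_irrefl _), if_pos rfl, ht, shiftPerm_self]
      · obtain ⟨m, rfl⟩ : ∃ m, j = m + 1 := ⟨j - 1, by omega⟩
        rw [if_neg (by omega), if_neg (by omega), Nat.add_sub_cancel, hx,
          shiftPerm_succ_of_le _ (by omega)]
    · intro j
      rw [AlgHom.comp_apply, insertT_t, ht, ev_t]
  have h2 : φ.comp (insertT (i + 1) i) = ev (shiftPerm i σ * simpleTransposition i) := by
    apply algHom_ext_xt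
    · intro j
      rw [AlgHom.comp_apply, insertT_x, ev_x]
      rcases lt_trichotomy j i with hj | rfl | hj
      · rw [if_pos (by omega), hx, Equiv.Perm.mul_apply,
          simpleTransposition_of_ne (by omega) (by omega), shiftPerm_of_lt _ hj]
      · rw [if_pos (by omega), hx, shiftPerm_mul_simpleTransposition_self]
      · obtain ⟨m, rfl⟩ : ∃ m, j = m + 1 := ⟨j - 1, by omega⟩
        rw [if_neg (by omega)]
        by_cases hm : m = i
        · rw [hm, if_pos rfl, ht, shiftPerm_mul_simpleTransposition_succ]
        · rw [if_neg (by omega), Nat.add_sub_cancel, hx, Equiv.Perm.mul_apply,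
            simpleTransposition_of_ne (by omega) (by omega), shiftPerm_succ_of_le _ (by omega)]
    · intro j
      rw [AlgHom.comp_apply, insertT_t, ht, ev_t]
  have h3 : φ.comp (omitT i) = (rename (skip i)).comp (ev σ) := by
    apply algHom_ext_xt
    · intro j
      rw [AlgHom.comp_apply, omitT_x, hx, AlgHom.comp_apply, ev_x, rename_X]
    · intro j
      rw [AlgHom.comp_apply, omitT_t, ht, AlgHom.comp_apply, ev_t, rename_X]
  have key := congrArg φ (sub_mul_equivariantTrim i f)
  rw [h, map_mul, map_sub, map_sub, hx, ht] at key
  rw [← h1, ← h2]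
  exact key.symm.trans (congrArg _ (DFunLike.congr_fun h3 g))

/-- The positive factor in the recursion for evaluations. -/
noncomputable def insertWeight (i : ℕ) (σ : Equiv.Perm ℕ) : MvPolynomial ℕ ℤ :=
  if σ i < i then X i - X (σ i) else X (σ i + 1) - X i

theorem ev_insertDesc {i : ℕ} {f g : PolTX} (h : equivariantTrim i f = omitT i g)
    (σ : Equiv.Perm ℕ) :
    ev (insertDesc i σ) f =
      ev (insertAsc i σ) f + insertWeight i σ * rename (skip i) (ev σ g) := by
  have key := ev_shiftPerm_mul_sub h σ
  unfold insertDesc insertAsc insertWeight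
  split_ifs with hi
  · rw [skip_of_lt hi] at key
    linear_combination -key
  · rw [skip_of_le (not_lt.1 hi)] at key
    linear_combination key

/-- A polynomial that is positive at all strictly increasing sequences. -/
def IsPosOnStrictMono (p : MvPolynomial ℕ ℤ) : Prop := ∀ s : ℕ → ℤ, StrictMono s → 0 < eval s p

theorem IsPosOnStrictMono.ne_zero {p : MvPolynomial ℕ ℤ} (h : IsPosOnStrictMono p) : p ≠ 0 := by
  rintro rfl
  simpa using h _ Nat.strictMono_cast

theorem IsPosOnStrictMono.add {p q : MvPolynomial ℕ ℤ} (hp : IsPosOnStrictMono p)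
    (hq : IsPosOnStrictMono q) : IsPosOnStrictMono (p + q) := fun s hs => by
  rw [map_add]
  exact add_pos (hp s hs) (hq s hs)

theorem IsPosOnStrictMono.mul {p q : MvPolynomial ℕ ℤ} (hp : IsPosOnStrictMono p)
    (hq : IsPosOnStrictMono q) : IsPosOnStrictMono (p * q) := fun s hs => by
  rw [map_mul]
  exact mul_pos (hp s hs) (hq s hs)

theorem IsPosOnStrictMono.rename_skip {p : MvPolynomial ℕ ℤ} (hp : IsPosOnStrictMono p) (i : ℕ) :
    IsPosOnStrictMono (rename (skip i) p) := fun s hs => by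
  rw [eval_rename]
  exact hp _ (hs.comp (skip_strictMono i))

theorem isPosOnStrictMono_insertWeight (i : ℕ) (σ : Equiv.Perm ℕ) :
    IsPosOnStrictMono (insertWeight i σ) := fun s hs => by
  unfold insertWeight
  split_ifs with h
  · simpa using hs h
  · simpa using hs (Nat.lt_succ_of_le (not_lt.1 h))

/-- The evaluation of a double forest polynomial at a noncrossing permutation is positive or zero,
according to the comparison of ranks. -/
theorem IsNC.ev_doubleForestPoly {n : ℕ} {σ : Equiv.Perm ℕ} (h : IsNC n σ) :
    ∀ F : IndexedForest, (RankLE F.perm σ → IsPosOnStrictMono (ev σ (doubleForestPoly F))) ∧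
      (¬ RankLE F.perm σ → ev σ (doubleForestPoly F) = 0) := by
  classical
  refine IsNC.induction ?_ ?_ h
  · intro F
    rw [ev_one_doubleForestPoly]
    constructor
    · intro hF
      have : F = IndexedForest.empty :=
        IndexedForest.perm_injective (hF.eq_one.trans IndexedForest.perm_empty.symm)
      rw [if_pos this]
      intro s _
      simp
    · intro hF
      refine if_neg ?_
      rintro rfl
      rw [IndexedForest.perm_empty] at hF
      exact hF fun b => ⟨le_rfl, le_rfl⟩
  · intro n i σ _ _ ih ihA F
    obtain ⟨hA1, hA2⟩ := ihA F
    by_cases hF : i ∈ F.qDes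
    · obtain ⟨G, rfl⟩ := IndexedForest.mem_qDes_iff.1 hF
      rw [ev_insertDesc (equivariantTrim_doubleForestPoly_graft G i)]
      obtain ⟨hG1, hG2⟩ := ih G
      have hiff : RankLE (G.graft i).perm (DoubleForest.insertDesc i σ) ↔ RankLE G.perm σ := by
        rw [G.perm_graft, rankLE_insertDesc_iff]
      rw [hiff]
      constructor
      · intro hr
        have hpos := (isPosOnStrictMono_insertWeight i σ).mul ((hG1 hr).rename_skip i)
        -- The second term is positive and the first is positive or zero, so they cannot cancel.
        by_cases hA : RankLE (G.graft i).perm (DoubleForest.insertAsc i σ)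
        · exact (hA1 hA).add hpos
        · rwa [hA2 hA, zero_add]
      · intro hr
        rw [hA2 fun hA => hr (hiff.1 (hA.trans (rankLE_insertAsc_insertDesc i σ))), hG2 hr,
          map_zero, mul_zero, add_zero]
    -- Without a terminal node at `i` neither the value nor the rank comparison distinguishes the
    -- two insertions.
    · have hiff : RankLE F.perm (DoubleForest.insertDesc i σ) ↔
          RankLE F.perm (DoubleForest.insertAsc i σ) :=
        ⟨fun h => h.insertAsc_or.resolve_right fun h' =>
          hF (IndexedForest.mem_qDes_of_perm h'.1 h'.2),
          fun h => h.trans (rankLE_insertAsc_insertDesc i σ)⟩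
      have htrim : equivariantTrim i (doubleForestPoly F) = omitT i 0 := by
        rw [map_zero, equivariantTrim_doubleForestPoly_of_notMem hF]
      rw [ev_insertDesc htrim, map_zero, map_zero, mul_zero, add_zero, hiff]
      exact ⟨hA1, hA2⟩

/-! ### The Bruhat order on noncrossing permutations -/

theorem IsNC.exists_isExactWord {n : ℕ} {σ : Equiv.Perm ℕ} (h : IsNC n σ) :
    ∃ w, IsExactWord w σ := by
  refine IsNC.induction ⟨[], isExactWord_nil⟩ ?_ h
  · intro n i σ _ _ _ ihA
    obtain ⟨w, hw⟩ := ihA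
    refine ⟨w ++ [i], ?_⟩
    rw [← insertAsc_mul]
    exact hw.concat (insertAsc_lt i σ)

theorem exists_mem_forestsOn (F : IndexedForest) : ∃ n, F ∈ forestsOn n := by
  obtain ⟨N, hN⟩ := F.exists_forall_tree_eq_nil
  refine ⟨F.start N, mem_forestsOn.2 fun j hj => F.start_strictMono.monotone ?_⟩
  exact not_le.1 fun h => hj (hN j h)

/-- Follows the recursion for `σ`: either `F.perm` lies below the ascent insertion, and `i` is
appended to the larger word only, or it has a descent across `i`, and `i` is appended to both. -/
theorem IsNC.exists_sublist {n : ℕ} {σ : Equiv.Perm ℕ} (h : IsNC n σ) :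
    ∀ F : IndexedForest, RankLE F.perm σ →
      ∃ v w, IsExactWord v F.perm ∧ IsExactWord w σ ∧ v.Sublist w := by
  refine IsNC.induction ?_ ?_ h
  · intro F hF
    rw [hF.eq_one]
    exact ⟨[], [], isExactWord_nil, isExactWord_nil, List.Sublist.refl _⟩
  · intro n i σ _ _ _ ihA F hF
    rcases hF.insertAsc_or with hA | hqd
    · obtain ⟨v, w, hv, hw, hvw⟩ := ihA F hA
      refine ⟨v, w ++ [i], hv, ?_, hvw.trans (List.sublist_append_left _ _)⟩
      rw [← insertAsc_mul]
      exact hw.concat (insertAsc_lt i σ)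
    · obtain ⟨G, rfl⟩ := IndexedForest.mem_qDes_iff.1 (IndexedForest.mem_qDes_of_perm hqd.1 hqd.2)
      obtain ⟨m, hm⟩ := exists_mem_forestsOn (G.graft i)
      have him := lt_of_graft_mem_forestsOn hm
      obtain ⟨m, rfl⟩ : ∃ k, m = k + 1 := ⟨m - 1, by omega⟩
      have hG := (IndexedForest.isNC_perm (mem_forestsOn_of_graft hm)).insertAsc
        (show i < m by omega)
      -- The induction hypothesis concerns permutations of forests; the ascent insertion into
      -- `G.perm` is one of these because it is noncrossing.
      obtain ⟨H, -, hH⟩ := hG.exists_perm_eq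
      rw [G.perm_graft, rankLE_insertDesc_iff] at hF
      obtain ⟨v, w, hv, hw, hvw⟩ := ihA H (hH ▸ hF.insertAsc i)
      rw [hH] at hv
      refine ⟨v ++ [i], w ++ [i], ?_, ?_, hvw.append_right _⟩
      · rw [G.perm_graft, ← insertAsc_mul]
        exact hv.concat (insertAsc_lt i _)
      · rw [← insertAsc_mul]
        exact hw.concat (insertAsc_lt i σ)

theorem IsNC.bruhatLE_iff {n : ℕ} {σ : Equiv.Perm ℕ} (h : IsNC n σ) (F : IndexedForest) :
    BruhatLE F.perm σ ↔ RankLE F.perm σ := by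
  refine ⟨fun hb => hb.rankLE h.exists_isExactWord, fun hr => ?_⟩
  obtain ⟨v, w, hv, hw, hvw⟩ := h.exists_sublist F hr
  exact ⟨v, w, hv.isReducedWord, hw.isReducedWord, hvw⟩

theorem ev_doubleForestPoly_eq_zero_iff {n : ℕ} {σ : Equiv.Perm ℕ} (hσ : σ ∈ noncrossingPerms n)
    {F : IndexedForest} (hF : F ∈ forestsOn n) :
    ev σ (doubleForestPoly F) = 0 ↔ ¬ BruhatLE (F.forToNC n) σ := by
  have hNC := mem_noncrossingPerms_iff.1 hσ
  rw [forToNC_eq_perm hF, hNC.bruhatLE_iff]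
  obtain ⟨h1, h2⟩ := hNC.ev_doubleForestPoly F
  exact ⟨fun h hr => (h1 hr).ne_zero h, h2⟩

end DoubleForest

theorem theorem8p10 :
    (∃! P : IndexedForest → PolTX, IsDoubleForestFamily P) ∧
    ∀ n : ℕ,
      Set.BijOn (IndexedForest.forToNC n) (forestsOn n) (noncrossingPerms n) ∧
      (∀ σ ∈ noncrossingPerms n, ∀ F ∈ forestsOn n,
        ev σ (doubleForestPoly F) = 0 ↔ ¬ BruhatLE (F.forToNC n) σ) ∧
      (∀ σ ∈ noncrossingPerms n, ∀ τ ∈ noncrossingPerms n,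
        BruhatLE τ σ ↔
          ev σ (doubleForestPoly
            (Function.invFunOn (IndexedForest.forToNC n) (forestsOn n) τ)) ≠ 0) := by
  refine ⟨existsUnique_isDoubleForestFamily, fun n => ⟨bijOn_forToNC n,
    fun σ hσ F hF => ev_doubleForestPoly_eq_zero_iff hσ hF, fun σ hσ τ hτ => ?_⟩⟩
  have hex : ∃ F ∈ forestsOn n, F.forToNC n = τ := (bijOn_forToNC n).surjOn hτ
  rw [ne_eq, ev_doubleForestPoly_eq_zero_iff hσ (Function.invFunOn_mem hex),
    Function.invFunOn_eq hex, not_not]
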